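/- Setting. Let $K$ be a smooth knot conformation: a simple closed $C^\infty$ curve in $\mathbb{R}^3$ with arc length parametrization $\mathbf{r}(s)$ and unit tangent vector $\mathbf{t}=\mathbf{r}'$. Let $\mathbf{b}(s)$ be a smooth unit vector field along $K$ (defined up to sign after one circuit of $K$) that is orthogonal to $\mathbf{r}'(s)$ and $\mathbf{r}''(s)$; the plane orthogonal to $\mathbf{b}(s)$ is called the osculating plane at $\mathbf{r}(s)$. Put $\mathbf{n}=\mathbf{b}\times\mathbf{t}$ and define the (possibly negative) curvature $\kappa$ and the torsion $\tau$ by $\mathbf{t}'=\kappa\mathbf{n}$ and $\mathbf{b}'=-\tau\mathbf{n}$. Assume that - $\mathbf{t}'$ and $\mathbf{b}'$ never vanish simultaneously, and each of them vanishes at only finitely many points of $K$; - the vectors $\pm\mathbf{t}$ at the points of $K$ where $\mathbf{t}'=0$ are pairwise distinct, and the vectors $\pm\mathbf{b}$ at the points of $K$ where $\mathbf{b}'=0$ are pairwise distinct. A $\kappa$-inflection point (respectively $\tau$-inflection point) is a point where $\kappa$ (respectively $\tau$) changes sign. The tantrix and the binotrix are the curves on the unit sphere $S^2$ traced by $\mathbf{t}$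 and $\mathbf{b}$; the anti-tantrix and the anti-binotrix are the curves traced by $-\mathbf{t}$ and $-\mathbf{b}$. For $\mathbf{v}\in S^2$, the bridge map counts the points of $K$ that are stationary points of the function $\langle \mathbf{v},\mathbf{r}\rangle$. The inflection map counts the points of $K$ that project to a cusp or to an inflection point under the orthogonal projection $\pi_{\mathbf{v}}$ onto the plane orthogonal to $\mathbf{v}$. Here $\mathbf{r}(s)$ projects to a cusp if $(\pi_{\mathbf{v}}\mathbf{r})'(s)=0$, and it projects to an inflection point if $(\pi_{\mathbf{v}}\mathbf{r})'(s)\neq 0$ and the osculating plane at $\mathbf{r}(s)$ is projected onto a line, the tangent line of the projected curve (where $\kappa(s)\ne0$ this means that the projected plane curve has zero curvature at $s$). The graph of a map on $S^2$ is the set of points of $S^2$ that have no open neighborhood in $S^2$ on which the map is constant. Theorem. The graph of the bridge map is the union of the binotrix, the anti-binotrix, and the great circles tangent to the binotrix and the anti-binotrix at the points corresponding to the $\kappa$-inflection points of $K$. The graph of the inflection map is the union of the tantrix, the anti-tantrix, and the great circles tangent to the tantrix and the anti-tantrix at the points corresponding to the $\tau$-inflection points of $K$. -/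

import Mathlib

open scoped ContDiff

noncomputable section

/-- Euclidean three-space. -/
abbrev E3 : Type := EuclideanSpace ℝ (Fin 3)

/-- The unit sphere `S²`. -/
abbrev S2 : Type := Metric.sphere (0 : E3) 1

/-- The cross product on Euclidean three-space. -/
def cross (x y : E3) : E3 :=
  WithLp.toLp 2 (crossProduct (WithLp.ofLp x) (WithLp.ofLp y))

/-- A smooth knot conformation: a simple closed smooth curve in three-space of length `length`,
parametrized by arc length, as a periodic function on the line. -/
structure KnotConformation where
  r : ℝ → E3
  length : ℝ
  length_pos : 0 < length
  smooth : ContDiff ℝ ∞ r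
  periodic : Function.Periodic r length
  unit_speed : ∀ s, ‖deriv r s‖ = 1
  simple : Set.InjOn r (Set.Ico 0 length)

namespace KnotConformation

/-- One period of parameters; since the curve is simple, these correspond bijectively to the
points of the knot. -/
def params (K : KnotConformation) : Set ℝ := Set.Ico 0 K.length

/-- The unit tangent vector `t`. -/
def t (K : KnotConformation) : ℝ → E3 := deriv K.r

/-- `b` is a smooth unit vector field along the knot which is normal to `r'` and `r''`, that is,
normal to the osculating planes. Going once around the knot may carry `b` to `b` or to `-b`. -/
structure IsBinormal (K : KnotConformation) (b : ℝ → E3) : Prop where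
  smooth : ContDiff ℝ ∞ b
  unit : ∀ s, ‖b s‖ = 1
  orth_t : ∀ s, inner ℝ (b s) (K.t s) = 0
  orth_dt : ∀ s, inner ℝ (b s) (deriv K.t s) = 0

/-- The genericity assumptions: `t'` and `b'` do not vanish simultaneously, each vanishes at only
finitely many points of the knot, the vectors `± t` at the points where `t'` vanishes are pairwise
distinct, and so are the vectors `± b` at the points where `b'` vanishes. -/
structure IsGeneric (K : KnotConformation) (b : ℝ → E3) : Prop where
  not_both : ∀ s, ¬ (deriv K.t s = 0 ∧ deriv b s = 0)
  finite_t : {s ∈ K.params | deriv K.t s = 0}.Finite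
  finite_b : {s ∈ K.params | deriv b s = 0}.Finite
  distinct_t : ∀ s ∈ K.params, ∀ s' ∈ K.params, deriv K.t s = 0 → deriv K.t s' = 0 → s ≠ s' →
    K.t s ≠ K.t s' ∧ K.t s ≠ -K.t s'
  distinct_b : ∀ s ∈ K.params, ∀ s' ∈ K.params, deriv b s = 0 → deriv b s' = 0 → s ≠ s' →
    b s ≠ b s' ∧ b s ≠ -b s'

/-- The unit normal vector `n = b × t`. -/
def n (K : KnotConformation) (b : ℝ → E3) (s : ℝ) : E3 := cross (b s) (K.t s)

/-- The curvature, given by `t' = κ n`; it may be negative. -/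
def curvature (K : KnotConformation) (b : ℝ → E3) (s : ℝ) : ℝ :=
  inner ℝ (deriv K.t s) (K.n b s)

/-- The torsion, given by `b' = -τ n`. -/
def torsion (K : KnotConformation) (b : ℝ → E3) (s : ℝ) : ℝ :=
  -inner ℝ (deriv b s) (K.n b s)

end KnotConformation

/-- The real function `f` changes sign at its zero `s`. -/
def ChangesSignAt (f : ℝ → ℝ) (s : ℝ) : Prop :=
  f s = 0 ∧
    (((∀ᶠ x in nhdsWithin s (Set.Iio s), f x < 0) ∧ ∀ᶠ x in nhdsWithin s (Set.Ioi s), 0 < f x) ∨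
      ((∀ᶠ x in nhdsWithin s (Set.Iio s), 0 < f x) ∧ ∀ᶠ x in nhdsWithin s (Set.Ioi s), f x < 0))

/-- The graph of a map on the sphere: the points having no open neighborhood on which the map is
constant. -/
def sphereGraph {α : Type*} (f : S2 → α) : Set S2 :=
  {p | ¬ ∃ U : Set S2, IsOpen U ∧ p ∈ U ∧ ∀ q ∈ U, ∀ q' ∈ U, f q = f q'}

/-- The set of points of the sphere on a curve. -/
def sphereTrace (C : ℝ → E3) : Set S2 := {v | ∃ s, (v : E3) = C s}

/-- The great circle tangent to the spherical curve `C` at its point `C s` (where `C' s ≠ 0`):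
the intersection of the sphere with the plane spanned by `C s` and `C' s`. -/
def tangentGreatCircle (C : ℝ → E3) (s : ℝ) : Set S2 :=
  {v | (v : E3) ∈ Submodule.span ℝ {C s, deriv C s}}

namespace KnotConformation

/-- The bridge map: the number of stationary points in the projection onto the axis of `v`. -/
def bridgeMap (K : KnotConformation) (v : S2) : ℕ∞ :=
  {s ∈ K.params | deriv (fun x => inner ℝ (v : E3) (K.r x)) s = 0}.encard

/-- The (direction of the) osculating plane: the plane normal to the binormal vector. It contains
`t` and `t'`, and is spanned by them where `t' ≠ 0`. -/
def osculatingPlane (b : ℝ → E3) (s : ℝ) : Submodule ℝ E3 := (ℝ ∙ b s)ᗮ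

/-- Orthogonal projection onto the plane orthogonal to `v`. -/
def projPlane (v : S2) : E3 →L[ℝ] E3 := (ℝ ∙ (v : E3))ᗮ.starProjection

/-- The projection of the knot onto the plane orthogonal to `v`. -/
def projCurve (K : KnotConformation) (v : S2) (s : ℝ) : E3 := projPlane v (K.r s)

/-- The projection of the knot has a cusp at `s`: its velocity vanishes. -/
def ProjectsToCusp (K : KnotConformation) (v : S2) (s : ℝ) : Prop :=
  deriv (K.projCurve v) s = 0

/-- The knot projects to an inflection point at `s`: the projection is regular there, and the
osculating plane of the knot is projected onto a line, namely the tangent line of the projection.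
Where `t' ≠ 0` this says that the curvature of the projected plane curve is zero; see
`projectsToInflection_iff`. -/
def ProjectsToInflection (K : KnotConformation) (b : ℝ → E3) (v : S2) (s : ℝ) : Prop :=
  deriv (K.projCurve v) s ≠ 0 ∧
    (osculatingPlane b s).map (projPlane v : E3 →ₗ[ℝ] E3) =
      Submodule.span ℝ {deriv (K.projCurve v) s}

/-- The inflection map: the number of inflection points and cusps in the projection onto the plane
orthogonal to `v`. -/
def inflectionMap (K : KnotConformation) (b : ℝ → E3) (v : S2) : ℕ∞ :=
  {s ∈ K.params | K.ProjectsToInflection b v s ∨ K.ProjectsToCusp v s}.encard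

theorem deriv_projCurve (K : KnotConformation) (v : S2) :
    deriv (K.projCurve v) = fun s => projPlane v (K.t s) := by
  funext s
  have h : DifferentiableAt ℝ K.r s := (K.smooth.differentiable (by simp)) s
  exact ((projPlane v).hasFDerivAt.comp_hasDerivAt s h.hasDerivAt).deriv

theorem deriv2_projCurve (K : KnotConformation) (v : S2) (s : ℝ) :
    deriv (deriv (K.projCurve v)) s = projPlane v (deriv K.t s) := by
  rw [deriv_projCurve]
  have h1 : ContDiff ℝ ∞ K.t := ((contDiff_infty_iff_deriv (f := K.r)).1 K.smooth).2
  have h : DifferentiableAt ℝ K.t s := (h1.differentiable (by simp)) s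
  exact ((projPlane v).hasFDerivAt.comp_hasDerivAt s h.hasDerivAt).deriv

theorem inner_t_deriv_t (K : KnotConformation) (s : ℝ) : inner ℝ (K.t s) (deriv K.t s) = 0 := by
  have h1 : ContDiff ℝ ∞ K.t := ((contDiff_infty_iff_deriv (f := K.r)).1 K.smooth).2
  have h : HasDerivAt K.t (deriv K.t s) s := ((h1.differentiable (by simp)) s).hasDerivAt
  have h2 := h.inner ℝ h
  have h3 : (fun x => inner ℝ (K.t x) (K.t x)) = fun _ => (1 : ℝ) := by
    funext x
    rw [real_inner_self_eq_norm_sq, t, K.unit_speed x]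
    norm_num
  rw [h3] at h2
  have h4 := h2.unique (hasDerivAt_const s (1 : ℝ))
  rw [real_inner_comm (K.t s) (deriv K.t s)] at h4
  have h5 := real_inner_comm (K.t s) (deriv K.t s)
  linarith

theorem osculatingPlane_eq_span (K : KnotConformation) (b : ℝ → E3) (hb : K.IsBinormal b) (s : ℝ)
    (hs : deriv K.t s ≠ 0) :
    osculatingPlane b s = Submodule.span ℝ {K.t s, deriv K.t s} := by
  have ht : K.t s ≠ 0 := by
    intro h
    have := K.unit_speed s
    rw [t] at h
    rw [h] at this
    simp at this
  have hb0 : b s ≠ 0 := by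
    intro h
    have := hb.unit s
    rw [h] at this
    simp at this
  have hli : LinearIndependent ℝ ![K.t s, deriv K.t s] := by
    rw [LinearIndependent.pair_iff' ht]
    intro a ha
    have h1 := K.inner_t_deriv_t s
    rw [← ha, inner_smul_right, real_inner_self_eq_norm_sq, t, K.unit_speed s] at h1
    apply hs
    rw [← ha]
    have : a = 0 := by simpa using h1
    simp [this]
  symm
  apply Submodule.eq_of_le_of_finrank_eq
  · rw [Submodule.span_le]
    intro x hx
    rw [osculatingPlane, SetLike.mem_coe, Submodule.mem_orthogonal_singleton_iff_inner_right]
    rcases hx with rfl | hx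
    · exact hb.orth_t s
    · rw [Set.mem_singleton_iff.1 hx]
      exact hb.orth_dt s
  · have h1 := finrank_span_eq_card hli
    have h2 : Set.range ![K.t s, deriv K.t s] = {K.t s, deriv K.t s} := by
      simp [Set.pair_comm]
    rw [h2] at h1
    rw [h1]
    have h3 := Submodule.finrank_add_finrank_orthogonal (ℝ ∙ b s)
    rw [finrank_span_singleton hb0, finrank_euclideanSpace] at h3
    simp only [Fintype.card_fin] at h3 ⊢
    rw [osculatingPlane]
    omega

/-- Where `t' ≠ 0`, projecting to an inflection point means that the projected plane curve is
regular with zero curvature: its first two derivatives are linearly dependent. -/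
theorem projectsToInflection_iff (K : KnotConformation) (b : ℝ → E3) (hb : K.IsBinormal b)
    (v : S2) (s : ℝ) (hs : deriv K.t s ≠ 0) :
    K.ProjectsToInflection b v s ↔
      deriv (K.projCurve v) s ≠ 0 ∧
        ¬ LinearIndependent ℝ ![deriv (K.projCurve v) s, deriv (deriv (K.projCurve v)) s] := by
  rw [ProjectsToInflection, osculatingPlane_eq_span K b hb s hs, deriv2_projCurve,
    deriv_projCurve]
  refine and_congr_right fun h0 => ?_
  rw [LinearIndependent.pair_iff' h0, Submodule.map_span, Set.image_pair]
  simp only [ContinuousLinearMap.coe_coe, not_forall, not_not]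
  constructor
  · intro h
    have h1 : projPlane v (deriv K.t s) ∈ Submodule.span ℝ {projPlane v (K.t s)} := by
      rw [← h]
      exact Submodule.subset_span (by simp)
    exact Submodule.mem_span_singleton.1 h1
  · rintro ⟨a, ha⟩
    apply le_antisymm
    · rw [Submodule.span_le]
      intro x hx
      rcases hx with rfl | hx
      · exact Submodule.mem_span_singleton_self _
      · rw [Set.mem_singleton_iff.1 hx]
        exact Submodule.mem_span_singleton.2 ⟨a, ha⟩
    · exact Submodule.span_mono (by simp)

end KnotConformation

end

/-!
The bridge map at `v` counts the zeros of `⟨v, t⟩` over a period. The inflection map at `v` counts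
those of `⟨v, b⟩`: a point projects to a cusp or an inflection point exactly if `v` lies in the
osculating plane. The frames `t, n, b` and `b, n, t` satisfy equations of the same shape,
`c' = κ n`, `n' = -κ c + τ d`, `d' = -τ n` (for the second frame with `-τ`, `-κ` in place of
`κ`, `τ`), so both halves are one theorem about such a frame `c, n, d`
(`IsGenericFrame.sphereGraph_eq`): the number of zeros of `⟨v, c⟩` is locally constant at `v`
except where `v = ± d s`, or where `v` is orthogonal to `c s` and `κ` changes sign at `s`.

The number of zeros over a period is a sum of local numbers (`eventually_zeroCount_eq`). The
derivative of `⟨v, c⟩` is `κ ⟨v, n⟩`, and at a zero, `⟨v, n⟩` vanishes only if `v = ± d`. Hence for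
`v` outside the exceptional set `⟨v, c⟩` is strictly monotone near each of its zeros, as is
`⟨w, c⟩` for `w` near `v`, and every zero persists (`IsGenericFrame.locallyConstantAt`).

At a point `v` of the exceptional set it is enough, as the set where the number is not locally
constant is closed, to find points close to `v` at which the number drops under a small push.

* Let `v = d x`. The zero `x` of `⟨v, c⟩` is degenerate, with second derivative `κ τ`, and
  pushing `v` to the side to which the curve `d` bends removes it. Other branches of `± d`
  through `v` could compensate for this only if they cross the curve `d` at `v`, or touch it and
  bend to the other side. Such coincidences are isolated as pairs of parameters
  (`IsGenericFrame.eventually_ne_of_not_sameSide`), so they occur for only countably many `x`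
  (`IsGenericFrame.countable_setOf_exceptional`), and a nearby `x` avoids them.
* Let `v` be orthogonal to `c s`, where `κ` changes sign at `s`. Then `⟨v, c⟩` has an extremum at
  its zero `s`, which a push along `± c s` removes. By the genericity of the knot, `v` can be
  moved along the great circle off those belonging to the other sign changes, and by the previous
  case off the curves `± d`; then all other zeros persist.
-/

section

open Filter Topology Set

/-! ### Isolated points and zeros -/

/-- A subset of a second countable space all of whose points are isolated is countable. -/
theorem countable_of_forall_isolated {X : Type*} [TopologicalSpace X] [SecondCountableTopology X]
    {S : Set X} (h : ∀ x ∈ S, ∀ᶠ y in 𝓝[≠] x, y ∉ S) : S.Countable := by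
  refine (HereditarilyLindelofSpace.isLindelof S).countable ?_
  rw [discreteTopology_subtype_iff]
  intro x hx
  rw [inf_principal_eq_bot]
  exact h x hx

/-- By Rolle's theorem, a function takes its value at `y` only at `y`, near `y`, if its derivative
has no further zeros near `y`. -/
theorem eventually_ne_of_deriv_ne {f f' : ℝ → ℝ} {y : ℝ} (hf : ∀ x, HasDerivAt f (f' x) x)
    (h : ∀ᶠ x in 𝓝[≠] y, f' x ≠ 0) : ∀ᶠ x in 𝓝[≠] y, f x ≠ f y := by
  have hc : Continuous f := continuous_iff_continuousAt.2 fun x => (hf x).continuousAt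
  rw [eventually_nhdsWithin_iff, Metric.eventually_nhds_iff_ball] at h ⊢
  obtain ⟨r, hr, h⟩ := h
  refine ⟨r, hr, fun x hx hxy he => ?_⟩
  rw [Real.ball_eq_Ioo] at h hx
  rcases lt_or_gt_of_ne (show x ≠ y from hxy) with hlt | hlt
  · obtain ⟨z, hz, hz0⟩ := exists_hasDerivAt_eq_zero hlt hc.continuousOn he fun x _ => hf x
    exact h z ⟨hx.1.trans hz.1, by linarith [hz.2]⟩ hz.2.ne hz0
  · obtain ⟨z, hz, hz0⟩ := exists_hasDerivAt_eq_zero hlt hc.continuousOn he.symm fun x _ => hf x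
    exact h z ⟨by linarith [hz.1], hz.2.trans hx.2⟩ hz.1.ne' hz0

/-! ### Counting zeros near a zero -/

/-- In all sufficiently small intervals around `y`, the function `⟨w, c ·⟩` has exactly `k` zeros,
eventually as `w` runs along the filter `l` (how far along may depend on the interval). -/
def LocalCount (c : ℝ → E3) (l : Filter E3) (y : ℝ) (k : ℕ) : Prop :=
  ∀ᶠ δ in 𝓝[>] (0 : ℝ), ∀ᶠ w in l, {s ∈ Metric.ball y δ | inner ℝ w (c s) = 0}.encard = k

theorem LocalCount.neg {c : ℝ → E3} {v : E3} {y : ℝ} {k : ℕ} (h : LocalCount c (𝓝 (-v)) y k) :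
    LocalCount c (𝓝 v) y k := by
  refine h.mono fun δ hδ => ?_
  have := (continuous_neg.tendsto v).eventually hδ
  simpa [inner_neg_left] using this

theorem continuous_inner_curve {c : ℝ → E3} (hc : Continuous c) :
    Continuous fun p : E3 × ℝ => (inner ℝ p.1 (c p.2) : ℝ) :=
  continuous_fst.inner (hc.comp continuous_snd)

theorem localCount_one_of_strictMonoOn {c : ℝ → E3} {v : E3} {y r : ℝ} (hc : Continuous c)
    (hv : inner ℝ v (c y) = 0) (hr : 0 < r)
    (h : ∀ᶠ w in 𝓝 v, StrictMonoOn (fun s => (inner ℝ w (c s) : ℝ)) (Icc (y - r) (y + r))) :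
    LocalCount c (𝓝 v) y 1 := by
  have hF := continuous_inner_curve hc
  filter_upwards [Ioo_mem_nhdsGT hr] with δ hδ
  have hself := h.self_of_nhds
  have h1 : (inner ℝ v (c (y - δ)) : ℝ) < 0 := by
    have := hself ⟨by linarith [hδ.2], by linarith [hδ.1]⟩ ⟨by linarith, by linarith⟩
      (show y - δ < y by linarith [hδ.1])
    simpa [hv] using this
  have h2 : (0 : ℝ) < inner ℝ v (c (y + δ)) := by
    have := hself ⟨by linarith, by linarith⟩ ⟨by linarith [hδ.1], by linarith [hδ.2]⟩
      (show y < y + δ by linarith [hδ.1])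
    simpa [hv] using this
  have hcw : ∀ s, Continuous fun w : E3 => (inner ℝ w (c s) : ℝ) := fun s => by fun_prop
  filter_upwards [h, (hcw (y - δ)).continuousAt.eventually_lt continuousAt_const h1,
    continuousAt_const.eventually_lt (hcw (y + δ)).continuousAt h2] with w hw hw1 hw2
  have hcs : Continuous fun s : ℝ => (inner ℝ w (c s) : ℝ) := continuous_const.inner hc
  obtain ⟨z, hz, hz0⟩ := intermediate_value_Ioo (show y - δ ≤ y + δ by linarith [hδ.1])
    hcs.continuousOn ⟨hw1, hw2⟩
  rw [Nat.cast_one, encard_eq_one]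
  refine ⟨z, ?_⟩
  ext s
  rw [Real.ball_eq_Ioo, mem_singleton_iff]
  constructor
  · rintro ⟨hs, hs0⟩
    exact hw.injOn ⟨by linarith [hs.1, hδ.2], by linarith [hs.2, hδ.2]⟩
      ⟨by linarith [hz.1, hδ.2], by linarith [hz.2, hδ.2]⟩ (hs0.trans hz0.symm)
  · rintro rfl
    exact ⟨hz, hz0⟩

theorem localCount_one_of_pos {c n : ℝ → E3} {κ : ℝ → ℝ} {v : E3} {y : ℝ}
    (hc : ∀ s, HasDerivAt c (κ s • n s) s) (hn : Continuous n) (hv : inner ℝ v (c y) = 0)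
    (hκ : ∀ᶠ x in 𝓝[≠] y, 0 < κ x) (hvn : (0 : ℝ) < inner ℝ v (n y)) :
    LocalCount c (𝓝 v) y 1 := by
  have hcc : Continuous c := continuous_iff_continuousAt.2 fun x => (hc x).continuousAt
  have h1 : ∀ᶠ p : E3 × ℝ in 𝓝 v ×ˢ 𝓝 y, (0 : ℝ) < inner ℝ p.1 (n p.2) := by
    rw [← nhds_prod_eq]
    exact continuousAt_const.eventually_lt (continuous_inner_curve hn).continuousAt hvn
  obtain ⟨P, hP, Q, hQ, hPQ⟩ := eventually_prod_iff.1 h1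
  rw [eventually_nhdsWithin_iff] at hκ
  obtain ⟨r, hr, hball⟩ := Metric.eventually_nhds_iff_ball.1 (hQ.and hκ)
  have hr2 : 0 < r / 2 := by positivity
  refine localCount_one_of_strictMonoOn hcc hv hr2 (hP.mono fun w hw => ?_)
  have hd : ∀ s, HasDerivAt (fun s => (inner ℝ w (c s) : ℝ)) (κ s * inner ℝ w (n s)) s := by
    intro s
    have := (hasDerivAt_const s w).inner ℝ (hc s)
    simpa [inner_smul_right] using this
  have hcs : Continuous fun s : ℝ => (inner ℝ w (c s) : ℝ) := continuous_const.inner hcc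
  have hpos : ∀ s ∈ Metric.ball y r, s ≠ y → 0 < deriv (fun s => (inner ℝ w (c s) : ℝ)) s := by
    intro s hs hsy
    rw [(hd s).deriv]
    exact mul_pos ((hball s hs).2 hsy) (hPQ hw (hball s hs).1)
  rw [Real.ball_eq_Ioo] at hpos
  have m1 : StrictMonoOn (fun s => (inner ℝ w (c s) : ℝ)) (Icc (y - r / 2) y) := by
    refine strictMonoOn_of_deriv_pos (convex_Icc _ _) hcs.continuousOn fun s hs => ?_
    rw [interior_Icc] at hs
    exact hpos s ⟨by linarith [hs.1], by linarith [hs.2]⟩ hs.2.ne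
  have m2 : StrictMonoOn (fun s => (inner ℝ w (c s) : ℝ)) (Icc y (y + r / 2)) := by
    refine strictMonoOn_of_deriv_pos (convex_Icc _ _) hcs.continuousOn fun s hs => ?_
    rw [interior_Icc] at hs
    exact hpos s ⟨by linarith [hs.1], by linarith [hs.2]⟩ hs.1.ne'
  have := m1.union m2 (isGreatest_Icc (by linarith)) (isLeast_Icc (by linarith))
  rwa [Icc_union_Icc_eq_Icc (by linarith) (by linarith)] at this

/-- A zero of `⟨v, c ·⟩` at which the derivative `κ ⟨v, n⟩` does not change sign persists, as
exactly one zero, under small changes of `v`. -/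
theorem localCount_one {c n : ℝ → E3} {κ : ℝ → ℝ} {v : E3} {y : ℝ}
    (hc : ∀ s, HasDerivAt c (κ s • n s) s) (hn : Continuous n) (hv : inner ℝ v (c y) = 0)
    (hκ : (∀ᶠ x in 𝓝[≠] y, 0 < κ x) ∨ ∀ᶠ x in 𝓝[≠] y, κ x < 0) (hvn : inner ℝ v (n y) ≠ (0 : ℝ)) :
    LocalCount c (𝓝 v) y 1 := by
  wlog hpos : ∀ᶠ x in 𝓝[≠] y, 0 < κ x generalizing κ n with H
  · have hneg := hκ.resolve_left hpos
    have h' : ∀ᶠ x in 𝓝[≠] y, 0 < -κ x := hneg.mono fun x hx => by linarith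
    exact H (κ := fun s => -κ s) (n := fun s => -n s) (fun s => by simpa using hc s) hn.neg
      (Or.inl h') (by simpa using hvn) h'
  rcases lt_or_gt_of_ne hvn with h | h
  · exact (localCount_one_of_pos hc hn (by simpa using hv) hpos (by simpa using h)).neg
  · exact localCount_one_of_pos hc hn hv hpos h

/-- A zero of `⟨v, c ·⟩` at which this function has a local extremum disappears when `v` is pushed
in a direction `u` in which the extremal value moves away from zero. -/
theorem localCount_zero {c : ℝ → E3} {v u : E3} {y σ : ℝ} (hc : Continuous c)
    (hext : ∀ᶠ x in 𝓝 y, 0 ≤ σ * inner ℝ v (c x)) (hu : 0 < σ * inner ℝ u (c y)) :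
    LocalCount c (map (fun ε : ℝ => v + ε • u) (𝓝[>] 0)) y 0 := by
  have h1 : ∀ᶠ x in 𝓝 y, 0 < σ * inner ℝ u (c x) :=
    continuousAt_const.eventually_lt (f := fun _ => (0 : ℝ))
      (g := fun x => σ * inner ℝ u (c x)) (by fun_prop) hu
  obtain ⟨r, hr, hball⟩ := Metric.eventually_nhds_iff_ball.1 (hext.and h1)
  filter_upwards [Ioo_mem_nhdsGT hr] with δ hδ
  rw [eventually_map]
  filter_upwards [self_mem_nhdsWithin] with ε hε
  rw [Nat.cast_zero, encard_eq_zero, eq_empty_iff_forall_notMem]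
  rintro s ⟨hs, hs0⟩
  have hs' := hball s (Metric.ball_subset_ball hδ.2.le hs)
  rw [inner_add_left, real_inner_smul_left] at hs0
  have h3 : 0 < ε * (σ * inner ℝ u (c s)) := mul_pos hε hs'.2
  have h4 : σ * (inner ℝ v (c s) + ε * inner ℝ u (c s)) = 0 := by rw [hs0, mul_zero]
  nlinarith [hs'.1]

/-- The constant family at `v` has one zero near an isolated zero. -/
theorem localCount_pure {c : ℝ → E3} {v : E3} {y : ℝ} (hv : inner ℝ v (c y) = 0)
    (h : ∀ᶠ x in 𝓝[≠] y, inner ℝ v (c x) ≠ (0 : ℝ)) : LocalCount c (pure v) y 1 := by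
  rw [eventually_nhdsWithin_iff, Metric.eventually_nhds_iff_ball] at h
  obtain ⟨r, hr, h⟩ := h
  filter_upwards [Ioo_mem_nhdsGT hr] with δ hδ
  rw [eventually_pure, Nat.cast_one, encard_eq_one]
  refine ⟨y, ?_⟩
  ext s
  rw [mem_singleton_iff]
  constructor
  · rintro ⟨hs, hs0⟩
    by_contra hne
    exact h s (Metric.ball_subset_ball hδ.2.le hs) hne hs0
  · rintro rfl
    exact ⟨Metric.mem_ball_self hδ.1, hv⟩

/-! ### Counting zeros over a period -/

/-- The number of zeros of `⟨w, c ·⟩` over the period `[0, L)`. -/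
noncomputable def zeroCount (L : ℝ) (c : ℝ → E3) (w : E3) : ℕ∞ :=
  {s ∈ Ico 0 L | inner ℝ w (c s) = 0}.encard

/-- A periodic set has equally many points in all half-open intervals of one period. -/
theorem encard_inter_Ico_eq {L : ℝ} (hL : 0 < L) {Z : Set ℝ} (hZ : ∀ s, s + L ∈ Z ↔ s ∈ Z)
    (a : ℝ) : (Ico 0 L ∩ Z).encard = (Ico a (a + L) ∩ Z).encard := by
  have hp : Function.Periodic (fun s => s ∈ Z) L := fun s => propext (hZ s)
  have hmem : ∀ a' s, toIcoMod hL a' s ∈ Z ↔ s ∈ Z := by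
    intro a' s
    rw [← self_sub_toIcoDiv_zsmul]
    exact iff_of_eq (hp.sub_zsmul_eq _)
  have himg : Ico a (a + L) ∩ Z = toIcoMod hL a '' (Ico 0 L ∩ Z) := by
    ext s
    constructor
    · rintro ⟨hs, hsZ⟩
      refine ⟨toIcoMod hL 0 s, ⟨toIcoMod_mem_Ico' hL s, (hmem 0 s).2 hsZ⟩, ?_⟩
      rw [toIcoMod_toIcoMod, (toIcoMod_eq_self hL).2 hs]
    · rintro ⟨x, ⟨_, hxZ⟩, rfl⟩
      exact ⟨toIcoMod_mem_Ico hL a x, (hmem a x).2 hxZ⟩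
  rw [himg, InjOn.encard_image]
  rintro x ⟨hx, _⟩ y ⟨hy, _⟩ hxy
  have := congrArg (toIcoMod hL 0) hxy
  rw [toIcoMod_toIcoMod, toIcoMod_toIcoMod] at this
  rwa [(toIcoMod_eq_self hL).2 (by simpa using hx), (toIcoMod_eq_self hL).2 (by simpa using hy)]
    at this

theorem finite_zeros_Icc {f : ℝ → ℝ} (hf : Continuous f)
    (hiso : ∀ y, f y = 0 → ∀ᶠ x in 𝓝[≠] y, f x ≠ 0) (a b : ℝ) :
    {s ∈ Icc a b | f s = 0}.Finite := by
  have hcl : IsClosed {s | f s = 0} := isClosed_eq hf continuous_const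
  have hK : IsCompact {s ∈ Icc a b | f s = 0} := isCompact_Icc.inter_right hcl
  refine hK.finite (isDiscrete_iff_discreteTopology.2 ?_)
  rw [discreteTopology_subtype_iff]
  rintro x ⟨_, hx⟩
  rw [inf_principal_eq_bot]
  exact (hiso x hx).mono fun z hz hz' => hz hz'.2

/-- If the zeros of `⟨v, c ·⟩` are isolated, then the number of zeros of `⟨w, c ·⟩` over a period
is, for `w` close to `v`, the sum of the local numbers. -/
theorem eventually_zeroCount_eq {L : ℝ} (hL : 0 < L) {c : ℝ → E3} (hc : Continuous c)
    (hper : ∀ w s, inner ℝ w (c (s + L)) = (0 : ℝ) ↔ inner ℝ w (c s) = (0 : ℝ)) {v : E3}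
    {l : Filter E3} (hl : l ≤ 𝓝 v) {m : ℝ → ℕ} {a : ℝ} (ha : inner ℝ v (c a) ≠ (0 : ℝ))
    {Z : Finset ℝ} (hZ : ∀ s, s ∈ Z ↔ s ∈ Icc a (a + L) ∧ inner ℝ v (c s) = (0 : ℝ))
    (hloc : ∀ y ∈ Z, LocalCount c l y (m y)) :
    ∀ᶠ w in l, zeroCount L c w = ((∑ y ∈ Z, m y : ℕ) : ℕ∞) := by
  have hF := continuous_inner_curve hc
  have haL : inner ℝ v (c (a + L)) ≠ (0 : ℝ) := fun h => ha ((hper v a).1 h)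
  have hZI : ∀ y ∈ Z, y ∈ Ioo a (a + L) := by
    intro y hy
    obtain ⟨hy1, hy2⟩ := (hZ y).1 hy
    refine ⟨lt_of_le_of_ne hy1.1 ?_, lt_of_le_of_ne hy1.2 ?_⟩
    · rintro rfl; exact ha hy2
    · rintro rfl; exact haL hy2
  -- a radius that works for all the finitely many zeros
  have hδ1 : ∀ᶠ δ in 𝓝[>] (0 : ℝ), ∀ y ∈ Z,
      ∀ᶠ w in l, {s ∈ Metric.ball y δ | inner ℝ w (c s) = 0}.encard = m y :=
    (Filter.eventually_all_finset Z).2 hloc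
  have hδ2 : ∀ᶠ δ in 𝓝[>] (0 : ℝ), ∀ y ∈ Z, Metric.ball y δ ⊆ Ioo a (a + L) := by
    refine (Filter.eventually_all_finset Z).2 fun y hy => ?_
    obtain ⟨r, hr, hsub⟩ := Metric.isOpen_iff.1 isOpen_Ioo y (hZI y hy)
    filter_upwards [Ioo_mem_nhdsGT hr] with δ hδ
    exact (Metric.ball_subset_ball hδ.2.le).trans hsub
  have hδ3 : ∀ᶠ δ in 𝓝[>] (0 : ℝ), ∀ y ∈ Z, ∀ z ∈ Z, y ≠ z →
      Disjoint (Metric.ball y δ) (Metric.ball z δ) := by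
    refine (Filter.eventually_all_finset Z).2 fun y _ => (Filter.eventually_all_finset Z).2
      fun z _ => ?_
    by_cases hyz : y = z
    · exact Eventually.of_forall fun _ h => absurd hyz h
    have hd : 0 < dist y z / 2 := half_pos (dist_pos.2 hyz)
    filter_upwards [Ioo_mem_nhdsGT hd] with δ hδ _
    exact Metric.ball_disjoint_ball (by linarith [hδ.2])
  obtain ⟨δ, ⟨⟨h1, h2⟩, h3⟩, hδ0⟩ :=
    (((hδ1.and hδ2).and hδ3).and self_mem_nhdsWithin).exists
  -- away from the zeros, compactness keeps the function from vanishing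
  have hK : IsCompact (Icc a (a + L) \ ⋃ y ∈ Z, Metric.ball y δ) :=
    isCompact_Icc.diff (isOpen_biUnion fun _ _ => Metric.isOpen_ball)
  have hoff : ∀ᶠ w in 𝓝 v, ∀ s ∈ Icc a (a + L) \ ⋃ y ∈ Z, Metric.ball y δ,
      (inner ℝ w (c s) : ℝ) ≠ 0 := by
    refine hK.eventually_forall_of_forall_eventually fun s hs => ?_
    refine hF.continuousAt.eventually_ne (show (inner ℝ v (c s) : ℝ) ≠ 0 from fun h0 => hs.2 ?_)
    exact mem_biUnion ((hZ s).2 ⟨hs.1, h0⟩) (Metric.mem_ball_self hδ0)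
  filter_upwards [hl hoff, (Filter.eventually_all_finset Z).2 h1] with w hw hw1
  have hset : Ico a (a + L) ∩ {s | (inner ℝ w (c s) : ℝ) = 0} =
      ⋃ y : Z, {s ∈ Metric.ball (y : ℝ) δ | inner ℝ w (c s) = (0 : ℝ)} := by
    ext s
    rw [mem_iUnion]
    constructor
    · rintro ⟨hs, hs0⟩
      by_contra hne
      refine hw s ⟨Ico_subset_Icc_self hs, fun hmem => hne ?_⟩ hs0
      obtain ⟨y, hy, hsy⟩ := mem_iUnion₂.1 hmem
      exact ⟨⟨y, hy⟩, hsy, hs0⟩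
    · rintro ⟨⟨y, hy⟩, hs, hs0⟩
      exact ⟨Ioo_subset_Ico_self (h2 y hy hs), hs0⟩
  have hcount : zeroCount L c w = (Ico a (a + L) ∩ {s | (inner ℝ w (c s) : ℝ) = 0}).encard :=
    encard_inter_Ico_eq hL (fun s => hper w s) a
  rw [hcount, hset, encard_iUnion_of_finite, finsum_eq_sum_of_fintype]
  · rw [Finset.sum_congr rfl fun (y : Z) _ => hw1 y y.2, Nat.cast_sum,
      Finset.sum_coe_sort Z fun y => ((m y : ℕ) : ℕ∞)]
  · rintro ⟨y, hy⟩ ⟨z, hz⟩ hyz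
    exact (h3 y hy z hz fun h => hyz (Subtype.ext h)).mono (fun _ h => h.1) fun _ h => h.1

/-! ### Frames along closed curves -/

/-- An orthonormal frame `c, n, d` along the line with `c' = κ n`, `n' = -κ c + τ d`, `d' = -τ n`,
such that `c` and `d` have period `L` up to sign, and which is generic: the zeros of `κ` and of `τ`
are isolated, `κ` and `τ` have no common zero, and at zeros of `κ` (of `τ`) that differ modulo `L`
the lines spanned by `c` (by `d`) are different. For a knot, both `t, n, b` and `b, n, t` are
such frames. -/
structure IsGenericFrame (L : ℝ) (c n d : ℝ → E3) (κ τ : ℝ → ℝ) : Prop where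
  pos : 0 < L
  cc : ∀ s, inner ℝ (c s) (c s) = (1 : ℝ)
  nn : ∀ s, inner ℝ (n s) (n s) = (1 : ℝ)
  dd : ∀ s, inner ℝ (d s) (d s) = (1 : ℝ)
  cn : ∀ s, inner ℝ (c s) (n s) = (0 : ℝ)
  cd : ∀ s, inner ℝ (c s) (d s) = (0 : ℝ)
  dn : ∀ s, inner ℝ (d s) (n s) = (0 : ℝ)
  expand : ∀ s w, w = (inner ℝ w (c s) : ℝ) • c s + (inner ℝ w (n s) : ℝ) • n s +
    (inner ℝ w (d s) : ℝ) • d s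
  hasDerivAt_c : ∀ s, HasDerivAt c (κ s • n s) s
  hasDerivAt_n : ∀ s, HasDerivAt n (-κ s • c s + τ s • d s) s
  hasDerivAt_d : ∀ s, HasDerivAt d (-τ s • n s) s
  differentiable_κ : Differentiable ℝ κ
  differentiable_τ : Differentiable ℝ τ
  periodic_c : ∀ s, c (s + L) = c s ∨ c (s + L) = -c s
  periodic_d : ∀ s, d (s + L) = d s ∨ d (s + L) = -d s
  not_both : ∀ s, ¬ (κ s = 0 ∧ τ s = 0)
  isolated_κ : ∀ s, ∀ᶠ x in 𝓝[≠] s, κ x ≠ 0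
  isolated_τ : ∀ s, ∀ᶠ x in 𝓝[≠] s, τ x ≠ 0
  distinct_c : ∀ s s', κ s = 0 → κ s' = 0 → (c s' = c s ∨ c s' = -c s) → ∃ k : ℤ, s' = s + k • L
  distinct_d : ∀ s s', τ s = 0 → τ s' = 0 → (d s' = d s ∨ d s' = -d s) → ∃ k : ℤ, s' = s + k • L

/-- The number of zeros of `⟨w, c ·⟩` is constant for `w` close to `v`. -/
def LocallyConstantAt (L : ℝ) (c : ℝ → E3) (v : E3) : Prop :=
  ∀ᶠ w in 𝓝 v, zeroCount L c w = zeroCount L c v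

theorem LocallyConstantAt.eventually {L : ℝ} {c : ℝ → E3} {v : E3}
    (h : LocallyConstantAt L c v) : ∀ᶠ w in 𝓝 v, LocallyConstantAt L c w := by
  filter_upwards [eventually_eventually_nhds.2 h, h] with w hw hwv
  exact hw.mono fun u hu => hu.trans hwv.symm

theorem zeroCount_smul {L : ℝ} {c : ℝ → E3} {v : E3} {a : ℝ} (ha : a ≠ 0) :
    zeroCount L c (a • v) = zeroCount L c v := by
  simp [zeroCount, real_inner_smul_left, ha]

theorem LocallyConstantAt.of_smul {L : ℝ} {c : ℝ → E3} {v : E3} {a : ℝ} (ha : a ≠ 0)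
    (h : LocallyConstantAt L c (a • v)) : LocallyConstantAt L c v := by
  have ht : Tendsto (fun w : E3 => a • w) (𝓝 v) (𝓝 (a • v)) := (continuous_const_smul a).tendsto v
  refine (ht.eventually h).mono fun w hw => ?_
  rwa [zeroCount_smul ha, zeroCount_smul ha] at hw

/-- A continuous function with no zeros on an interval has one sign there. -/
theorem pos_or_neg_of_ne_zero {κ : ℝ → ℝ} (hκ : Continuous κ) {a b : ℝ}
    (h : ∀ x ∈ Ioo a b, κ x ≠ 0) : (∀ x ∈ Ioo a b, 0 < κ x) ∨ ∀ x ∈ Ioo a b, κ x < 0 := by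
  by_contra! hcon
  obtain ⟨⟨x, hx, hx0⟩, y, hy, hy0⟩ := hcon
  obtain ⟨z, hz, hz0⟩ := isPreconnected_Ioo.intermediate_value hx hy hκ.continuousOn ⟨hx0, hy0⟩
  exact h z hz hz0

/-- Near an isolated zero at which it does not change sign, or near a point where it does not
vanish, a continuous function has one sign. -/
theorem eventually_pos_or_neg {κ : ℝ → ℝ} (hκ : Continuous κ) {s : ℝ}
    (h : ∀ᶠ x in 𝓝[≠] s, κ x ≠ 0) (hs : ¬ ChangesSignAt κ s) :
    (∀ᶠ x in 𝓝[≠] s, 0 < κ x) ∨ ∀ᶠ x in 𝓝[≠] s, κ x < 0 := by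
  by_cases h0 : κ s = 0
  · rw [eventually_nhdsWithin_iff, Metric.eventually_nhds_iff_ball] at h
    obtain ⟨r, hr, h⟩ := h
    rw [Real.ball_eq_Ioo] at h
    have hl : Ioo (s - r) s ∈ 𝓝[<] s := Ioo_mem_nhdsLT (by linarith)
    have hg : Ioo s (s + r) ∈ 𝓝[>] s := Ioo_mem_nhdsGT (by linarith)
    simp only [← nhdsLT_sup_nhdsGT, eventually_sup]
    rcases pos_or_neg_of_ne_zero hκ (a := s - r) (b := s)
        fun x hx => h x ⟨hx.1, by linarith [hx.2]⟩ hx.2.ne with h1 | h1 <;>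
      rcases pos_or_neg_of_ne_zero hκ (a := s) (b := s + r)
        fun x hx => h x ⟨by linarith [hx.1], hx.2⟩ hx.1.ne' with h2 | h2
    · exact Or.inl ⟨mem_of_superset hl h1, mem_of_superset hg h2⟩
    · exact absurd ⟨h0, Or.inr ⟨mem_of_superset hl h1, mem_of_superset hg h2⟩⟩ hs
    · exact absurd ⟨h0, Or.inl ⟨mem_of_superset hl h1, mem_of_superset hg h2⟩⟩ hs
    · exact Or.inr ⟨mem_of_superset hl h1, mem_of_superset hg h2⟩
  · rcases lt_or_gt_of_ne h0 with h0 | h0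
    · exact Or.inr (nhdsWithin_le_nhds (hκ.continuousAt.eventually_lt continuousAt_const h0))
    · exact Or.inl (nhdsWithin_le_nhds (continuousAt_const.eventually_lt hκ.continuousAt h0))

/-- If the derivative of `f` is `κ g` where `κ` changes sign at `s` and `g s ≠ 0`, then `f` has a
local extremum at `s`. -/
theorem ChangesSignAt.exists_extremum {f g κ : ℝ → ℝ} {s : ℝ} (h : ChangesSignAt κ s)
    (hf : ∀ x, HasDerivAt f (κ x * g x) x) (hg : Continuous g) (hgs : g s ≠ 0) :
    ∃ σ : ℝ, σ ≠ 0 ∧ ∀ᶠ x in 𝓝 s, σ * f s ≤ σ * f x := by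
  obtain ⟨S, hS, hl, hr⟩ : ∃ S : ℝ, S ≠ 0 ∧ (∀ᶠ x in 𝓝[<] s, S * κ x ≤ 0) ∧
      ∀ᶠ x in 𝓝[>] s, 0 ≤ S * κ x := by
    rcases h.2 with ⟨h1, h2⟩ | ⟨h1, h2⟩
    · exact ⟨1, one_ne_zero, h1.mono fun x hx => by linarith, h2.mono fun x hx => by linarith⟩
    · exact ⟨-1, by norm_num, h1.mono fun x hx => by linarith, h2.mono fun x hx => by linarith⟩
  have hgg : ∀ᶠ x in 𝓝 s, 0 < g s * g x :=
    continuousAt_const.eventually_lt (f := fun _ => (0 : ℝ)) (g := fun x => g s * g x)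
      (by fun_prop) (mul_self_pos.2 hgs)
  have hd : ∀ x, HasDerivAt (fun x => S * g s * f x) (S * g s * (κ x * g x)) x :=
    fun x => (hf x).const_mul _
  refine ⟨S * g s, mul_ne_zero hS hgs, ?_⟩
  refine isLocalMin_of_deriv (hd s).continuousAt
    (Eventually.of_forall fun x => (hd x).differentiableAt) ?_ ?_
  · filter_upwards [hl, nhdsWithin_le_nhds hgg] with x h1 h2
    rw [(hd x).deriv]
    nlinarith [mul_nonneg (neg_nonneg.2 h1) h2.le]
  · filter_upwards [hr, nhdsWithin_le_nhds hgg] with x h1 h2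
    rw [(hd x).deriv]
    nlinarith [mul_nonneg h1 h2.le]

namespace IsGenericFrame

variable {L : ℝ} {c n d : ℝ → E3} {κ τ : ℝ → ℝ}

/-- Reversing a generic frame gives a generic frame: this is the duality between `t` and `b`. -/
theorem swap (F : IsGenericFrame L c n d κ τ) :
    IsGenericFrame L d n c (fun s => -τ s) (fun s => -κ s) where
  pos := F.pos
  cc := F.dd
  nn := F.nn
  dd := F.cc
  cn := F.dn
  cd s := by rw [real_inner_comm]; exact F.cd s
  dn := F.cn
  expand s w := by
    conv_lhs => rw [F.expand s w]
    abel
  hasDerivAt_c := F.hasDerivAt_d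
  hasDerivAt_n s := by
    have := F.hasDerivAt_n s
    rw [add_comm] at this
    simpa using this
  hasDerivAt_d s := by simpa using F.hasDerivAt_c s
  differentiable_κ := F.differentiable_τ.neg
  differentiable_τ := F.differentiable_κ.neg
  periodic_c := F.periodic_d
  periodic_d := F.periodic_c
  not_both s h := F.not_both s ⟨neg_eq_zero.1 h.2, neg_eq_zero.1 h.1⟩
  isolated_κ s := (F.isolated_τ s).mono fun x hx => neg_ne_zero.2 hx
  isolated_τ s := (F.isolated_κ s).mono fun x hx => neg_ne_zero.2 hx
  distinct_c s s' h h' := F.distinct_d s s' (neg_eq_zero.1 h) (neg_eq_zero.1 h')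
  distinct_d s s' h h' := F.distinct_c s s' (neg_eq_zero.1 h) (neg_eq_zero.1 h')

theorem continuous_c (F : IsGenericFrame L c n d κ τ) : Continuous c :=
  continuous_iff_continuousAt.2 fun x => (F.hasDerivAt_c x).continuousAt

theorem continuous_n (F : IsGenericFrame L c n d κ τ) : Continuous n :=
  continuous_iff_continuousAt.2 fun x => (F.hasDerivAt_n x).continuousAt

theorem continuous_d (F : IsGenericFrame L c n d κ τ) : Continuous d :=
  F.swap.continuous_c

theorem inner_periodic (F : IsGenericFrame L c n d κ τ) (w : E3) (s : ℝ) :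
    inner ℝ w (c (s + L)) = (0 : ℝ) ↔ inner ℝ w (c s) = (0 : ℝ) := by
  rcases F.periodic_c s with h | h <;> simp [h]

theorem hasDerivAt_inner_c (F : IsGenericFrame L c n d κ τ) (w : E3) (s : ℝ) :
    HasDerivAt (fun s => (inner ℝ w (c s) : ℝ)) (κ s * inner ℝ w (n s)) s := by
  have := (hasDerivAt_const s w).inner ℝ (F.hasDerivAt_c s)
  simpa [inner_smul_right] using this

/-- The second derivative of `⟨w, c ·⟩` at a degenerate zero. -/
theorem hasDerivAt_deriv_inner_c (F : IsGenericFrame L c n d κ τ) {w : E3} {y : ℝ}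
    (h0 : inner ℝ w (c y) = (0 : ℝ)) (h1 : inner ℝ w (n y) = (0 : ℝ)) :
    HasDerivAt (fun s => κ s * (inner ℝ w (n s) : ℝ)) (κ y * τ y * inner ℝ w (d y)) y := by
  have h2 := (hasDerivAt_const y w).inner ℝ (F.hasDerivAt_n y)
  have h3 := (F.differentiable_κ y).hasDerivAt.mul h2
  refine h3.congr_deriv ?_
  simp only [h1, mul_zero, inner_add_right, inner_smul_right, inner_zero_left, h0, add_zero,
    zero_add]
  ring

theorem eq_smul_d (F : IsGenericFrame L c n d κ τ) {w : E3} {y : ℝ}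
    (h0 : inner ℝ w (c y) = (0 : ℝ)) (h1 : inner ℝ w (n y) = (0 : ℝ)) :
    w = (inner ℝ w (d y) : ℝ) • d y := by
  conv_lhs => rw [F.expand y w]
  simp [h0, h1]

/-- A unit vector orthogonal to `c` and `n` is `d` or `-d`. -/
theorem inner_d_eq (F : IsGenericFrame L c n d κ τ) {w : E3} {y : ℝ}
    (hw : inner ℝ w w = (1 : ℝ))
    (h0 : inner ℝ w (c y) = (0 : ℝ)) (h1 : inner ℝ w (n y) = (0 : ℝ)) :
    (inner ℝ w (d y) : ℝ) = 1 ∨ (inner ℝ w (d y) : ℝ) = -1 := by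
  have h := F.eq_smul_d h0 h1
  have h2 : (inner ℝ w w : ℝ) = inner ℝ w (d y) * inner ℝ w (d y) :=
    (congrArg (fun x => (inner ℝ w x : ℝ)) h).trans (real_inner_smul_right _ _ _)
  rw [hw] at h2
  exact mul_self_eq_one_iff.1 h2.symm

/-- The second derivative test at a degenerate zero of `⟨w, c ·⟩`. -/
theorem eventually_pos_of_degenerate (F : IsGenericFrame L c n d κ τ) {w : E3} {y σ : ℝ}
    (h0 : inner ℝ w (c y) = (0 : ℝ)) (h1 : inner ℝ w (n y) = (0 : ℝ))
    (hσ : 0 < σ * (κ y * τ y * inner ℝ w (d y))) :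
    ∀ᶠ x in 𝓝[≠] y, 0 < σ * (inner ℝ w (c x) : ℝ) := by
  have hf : ∀ x, HasDerivAt (fun s => σ * (inner ℝ w (c s) : ℝ))
      (σ * (κ x * inner ℝ w (n x))) x := fun x => (F.hasDerivAt_inner_c w x).const_mul σ
  have hf' := (F.hasDerivAt_deriv_inner_c h0 h1).const_mul σ
  have hd : deriv (fun s => σ * (inner ℝ w (c s) : ℝ)) = fun x => σ * (κ x * inner ℝ w (n x)) :=
    funext fun x => (hf x).deriv
  have hmin : IsLocalMin (fun s => σ * (inner ℝ w (c s) : ℝ)) y := by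
    refine isLocalMin_of_deriv_deriv_pos ?_ ?_ (hf y).continuousAt
    · rw [hd, hf'.deriv]
      exact hσ
    · simp [hd, h1]
  have hne := eventually_ne_of_deriv_ne hf (y := y)
    (by simpa using hf'.eventually_ne (c := 0) hσ.ne')
  filter_upwards [nhdsWithin_le_nhds hmin, hne] with x h2 h3
  simp only [h0, mul_zero] at h2 h3
  exact lt_of_le_of_ne h2 h3.symm

theorem isolated_of_inner_n_ne (F : IsGenericFrame L c n d κ τ) {w : E3} {y : ℝ}
    (h0 : inner ℝ w (c y) = (0 : ℝ)) (h1 : inner ℝ w (n y) ≠ (0 : ℝ)) :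
    ∀ᶠ x in 𝓝[≠] y, (inner ℝ w (c x) : ℝ) ≠ 0 := by
  have hn : Continuous fun x => (inner ℝ w (n x) : ℝ) := continuous_const.inner F.continuous_n
  have := eventually_ne_of_deriv_ne (F.hasDerivAt_inner_c w) (y := y) (by
    filter_upwards [F.isolated_κ y, nhdsWithin_le_nhds (hn.continuousAt.eventually_ne h1)]
      with x h2 h3 using mul_ne_zero h2 h3)
  simpa [h0] using this

theorem isolated_of_degenerate (F : IsGenericFrame L c n d κ τ) {w : E3} {y : ℝ} (hw : w ≠ 0)
    (hy : κ y * τ y ≠ 0) (h0 : inner ℝ w (c y) = (0 : ℝ)) (h1 : inner ℝ w (n y) = (0 : ℝ)) :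
    ∀ᶠ x in 𝓝[≠] y, (inner ℝ w (c x) : ℝ) ≠ 0 := by
  have hd : (inner ℝ w (d y) : ℝ) ≠ 0 := by
    intro h
    apply hw
    rw [F.eq_smul_d h0 h1, h, zero_smul]
  exact (F.eventually_pos_of_degenerate (σ := κ y * τ y * inner ℝ w (d y)) h0 h1
    (mul_self_pos.2 (mul_ne_zero hy hd))).mono fun x hx hx0 => by simp [hx0] at hx

theorem exists_inner_ne_zero {L : ℝ} (hL : 0 < L) {w : E3} {s : ℝ}
    (h : ∀ᶠ x in 𝓝[≠] s, (inner ℝ w (c x) : ℝ) ≠ 0) :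
    ∃ a ∈ Ioo (s - L) s, (inner ℝ w (c a) : ℝ) ≠ 0 := by
  have h1 : ∀ᶠ x in 𝓝[<] s, (inner ℝ w (c x) : ℝ) ≠ 0 := nhdsLT_le_nhdsNE s h
  have h2 : ∀ᶠ x in 𝓝[<] s, x ∈ Ioo (s - L) s := Ioo_mem_nhdsLT (by linarith)
  exact (h2.and h1).exists

theorem exists_finset_zeros (F : IsGenericFrame L c n d κ τ) {w : E3}
    (h : ∀ y, inner ℝ w (c y) = (0 : ℝ) → ∀ᶠ x in 𝓝[≠] y, (inner ℝ w (c x) : ℝ) ≠ 0) (a : ℝ) :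
    ∃ Z : Finset ℝ, ∀ s, s ∈ Z ↔ s ∈ Icc a (a + L) ∧ inner ℝ w (c s) = (0 : ℝ) := by
  have hcs : Continuous fun s : ℝ => (inner ℝ w (c s) : ℝ) := continuous_const.inner F.continuous_c
  exact ⟨(finite_zeros_Icc hcs h a (a + L)).toFinset, fun s => by simp⟩

/-! ### Where the number of zeros is locally constant -/

/-- If `v` is not a multiple of a vector `d s`, and is not orthogonal to `c s` for any sign
change `s` of `κ`, then every zero of `⟨v, c ·⟩` persists under small changes of `v`. -/
theorem locallyConstantAt (F : IsGenericFrame L c n d κ τ) {v : E3}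
    (h1 : ∀ s, inner ℝ v (c s) = (0 : ℝ) → (inner ℝ v (n s) : ℝ) ≠ 0)
    (h2 : ∀ s, ChangesSignAt κ s → (inner ℝ v (c s) : ℝ) ≠ 0) : LocallyConstantAt L c v := by
  have hiso : ∀ y, inner ℝ v (c y) = (0 : ℝ) → ∀ᶠ x in 𝓝[≠] y, (inner ℝ v (c x) : ℝ) ≠ 0 :=
    fun y hy => F.isolated_of_inner_n_ne hy (h1 y hy)
  obtain ⟨a, ha⟩ : ∃ a, (inner ℝ v (c a) : ℝ) ≠ 0 := by
    by_contra! hcon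
    obtain ⟨a, _, ha⟩ := exists_inner_ne_zero F.pos (hiso 0 (hcon 0))
    exact ha (hcon a)
  obtain ⟨Z, hZ⟩ := F.exists_finset_zeros hiso a
  have := eventually_zeroCount_eq F.pos F.continuous_c F.inner_periodic le_rfl (m := fun _ => 1)
    ha hZ fun y hy => by
      have hy0 := ((hZ y).1 hy).2
      exact localCount_one F.hasDerivAt_c F.continuous_n hy0 (eventually_pos_or_neg
        F.differentiable_κ.continuous (F.isolated_κ y) fun hs => h2 y hs hy0) (h1 y hy0)
  exact this.mono fun w hw => hw.trans this.self_of_nhds.symm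

/-! ### Where the number of zeros drops -/

/-- If every zero of `⟨v, c ·⟩` either persists or disappears when `v` is pushed in the direction
`u`, and the zero `s₀` disappears, then the number of zeros is not locally constant at `v`. -/
theorem not_locallyConstantAt_of_drop (F : IsGenericFrame L c n d κ τ) {v u : E3} {s₀ : ℝ}
    (hs₀ : inner ℝ v (c s₀) = (0 : ℝ))
    (hiso : ∀ y, inner ℝ v (c y) = (0 : ℝ) → ∀ᶠ x in 𝓝[≠] y, (inner ℝ v (c x) : ℝ) ≠ 0)
    (h0 : LocalCount c (map (fun ε : ℝ => v + ε • u) (𝓝[>] 0)) s₀ 0)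
    (h : ∀ y, |y - s₀| < L → inner ℝ v (c y) = (0 : ℝ) →
      LocalCount c (map (fun ε : ℝ => v + ε • u) (𝓝[>] 0)) y 0 ∨ LocalCount c (𝓝 v) y 1) :
    ¬ LocallyConstantAt L c v := by
  classical
  intro hlc
  set l := map (fun ε : ℝ => v + ε • u) (𝓝[>] 0) with hl
  have hlv : l ≤ 𝓝 v := by
    have ht : Tendsto (fun ε : ℝ => v + ε • u) (𝓝 0) (𝓝 (v + (0 : ℝ) • u)) :=
      Continuous.tendsto (by fun_prop) 0
    rw [zero_smul, add_zero] at ht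
    exact ht.mono_left nhdsWithin_le_nhds
  obtain ⟨a, ha, ha0⟩ := exists_inner_ne_zero F.pos (hiso s₀ hs₀)
  obtain ⟨Z, hZ⟩ := F.exists_finset_zeros hiso a
  have haL : (inner ℝ v (c (a + L)) : ℝ) ≠ 0 := fun h => ha0 ((F.inner_periodic v a).1 h)
  have hself : zeroCount L c v = ((∑ y ∈ Z, 1 : ℕ) : ℕ∞) :=
    eventually_pure.1 (eventually_zeroCount_eq F.pos F.continuous_c F.inner_periodic
      (pure_le_nhds v) (m := fun _ => 1) ha0 hZ fun y hy =>
        localCount_pure ((hZ y).1 hy).2 (hiso y ((hZ y).1 hy).2))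
  have hl' := eventually_zeroCount_eq F.pos F.continuous_c F.inner_periodic hlv
    (m := fun y => if LocalCount c l y 0 then 0 else 1) ha0 hZ fun y hy => by
      obtain ⟨hyI, hy0⟩ := (hZ y).1 hy
      by_cases hc0 : LocalCount c l y 0
      · simp [hc0]
      · have hya : y ≠ a := fun h => ha0 (h ▸ hy0)
        have hyaL : y ≠ a + L := fun h => haL (h ▸ hy0)
        have h3 := lt_of_le_of_ne hyI.1 hya.symm
        have h4 := lt_of_le_of_ne hyI.2 hyaL
        have := (h y (abs_lt.2 ⟨by linarith [ha.1], by linarith [ha.2]⟩) hy0).resolve_left hc0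
        simp only [hc0, if_false]
        exact this.mono fun δ hδ => hlv hδ
  obtain ⟨w, hw1, hw2⟩ := (hl'.and (hlv hlc)).exists
  rw [hw1, hself, Nat.cast_inj] at hw2
  refine (Finset.sum_lt_sum (f := fun y => if LocalCount c l y 0 then 0 else 1)
    (g := fun _ => 1) (s := Z) (fun y _ => by split_ifs <;> simp) ⟨s₀, ?_, ?_⟩).ne hw2
  · exact (hZ s₀).2 ⟨⟨ha.2.le, by linarith [ha.1]⟩, hs₀⟩
  · simp [h0]

end IsGenericFrame

namespace IsGenericFrame

variable {L : ℝ} {c n d : ℝ → E3} {κ τ : ℝ → ℝ}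

/-! ### The number of zeros jumps along the curve `± d` -/

/-- When `d y = σ d x` with `σ = ± 1`: the curves `d` at `y` and `σ d` at `x` touch, and bend to the
same side of their common tangent great circle. As `⟨c x, d ·⟩` has second derivative
`κ x * τ x` at `x`, the latter is a condition on the sign of a product. -/
def SameSide (c : ℝ → E3) (κ τ : ℝ → ℝ) (σ : ℝ) (x y : ℝ) : Prop :=
  ∃ ρ : ℝ, c y = ρ • c x ∧ 0 < σ * ρ * (κ x * τ x) * (κ y * τ y)

/-- Where the curves `d` and `σ d` cross each other, or touch but bend to different sides, they
have no further common points nearby. -/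
theorem eventually_ne_of_not_sameSide (F : IsGenericFrame L c n d κ τ) {σ x y : ℝ}
    (hσ : σ = 1 ∨ σ = -1) (hx : κ x * τ x ≠ 0) (hy : κ y * τ y ≠ 0) (hxy : d y = σ • d x)
    (hbad : ¬ SameSide c κ τ σ x y) : ∀ᶠ p in 𝓝[≠] (x, y), d p.2 ≠ σ • d p.1 := by
  have hσ2 : σ * σ = 1 := mul_self_eq_one_iff.2 hσ
  have hcyd : (inner ℝ (c y) (d x) : ℝ) = 0 := by
    have h1 : d x = σ • d y := by rw [hxy, smul_smul, hσ2, one_smul]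
    rw [h1, real_inner_smul_right, F.cd, mul_zero]
  by_cases hcn : (inner ℝ (c y) (n x) : ℝ) = 0
  · -- the curves touch: strictly on different sides of their common tangent great circle
    obtain ⟨ρ, hρ, hcyx⟩ : ∃ ρ : ℝ, ρ * ρ = 1 ∧ c y = ρ • c x :=
      ⟨_, mul_self_eq_one_iff.2 (F.swap.inner_d_eq (F.cc y) hcyd hcn), F.swap.eq_smul_d hcyd hcn⟩
    have hcxy : c x = ρ • c y := by rw [hcyx, smul_smul, hρ, one_smul]
    have hneg : σ * ρ * (κ x * τ x) * (κ y * τ y) < 0 := by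
      refine lt_of_le_of_ne (not_lt.1 fun h => hbad ⟨ρ, hcyx, h⟩) ?_
      have hσ0 : σ ≠ 0 := fun h => by simp [h] at hσ2
      have hρ0 : ρ ≠ 0 := fun h => by simp [h] at hρ
      exact mul_ne_zero (mul_ne_zero (mul_ne_zero hσ0 hρ0) hx) hy
    have h1 : ∀ᶠ z in 𝓝[≠] x, 0 < (κ x * τ x) * (inner ℝ (c x) (d z) : ℝ) := by
      refine F.swap.eventually_pos_of_degenerate (F.cd x) (F.cn x) ?_
      rw [F.cc, mul_one, neg_mul_neg, mul_comm (τ x)]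
      exact mul_self_pos.2 hx
    have h2 : ∀ᶠ z in 𝓝[≠] y, 0 < (-(σ * (κ x * τ x))) * (inner ℝ (c x) (d z) : ℝ) := by
      refine F.swap.eventually_pos_of_degenerate ?_ ?_ ?_
      · rw [hcxy, real_inner_smul_left, F.cd, mul_zero]
      · rw [hcxy, real_inner_smul_left, F.cn, mul_zero]
      · rw [hcxy, real_inner_smul_left, F.cc]
        nlinarith
    rw [eventually_nhdsWithin_iff] at h1 h2 ⊢
    rw [nhds_prod_eq]
    filter_upwards [h1.prod_mk h2] with p hp hne heq
    have hg : (inner ℝ (c x) (d p.2) : ℝ) = σ * inner ℝ (c x) (d p.1) := by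
      rw [heq, real_inner_smul_right]
    have hg2 : -(σ * (κ x * τ x)) * (inner ℝ (c x) (d p.2) : ℝ) =
        -((κ x * τ x) * inner ℝ (c x) (d p.1)) := by
      rw [hg]
      linear_combination (-(κ x * τ x) * (inner ℝ (c x) (d p.1) : ℝ)) * hσ2
    by_cases hp1 : p.1 = x
    · have hp2 : p.2 ≠ y := fun h => hne (Prod.ext hp1 h)
      have := hp.2 hp2
      rw [hg2, hp1, F.cd] at this
      simp at this
    · have h3 := hp.1 hp1
      by_cases hp2 : p.2 = y
      · have h4 : (inner ℝ (c x) (d p.2) : ℝ) = 0 := by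
          rw [hp2, hcxy, real_inner_smul_left, F.cd, mul_zero]
        rw [h4, mul_zero] at hg2
        linarith
      · have h4 := hp.2 hp2
        rw [hg2] at h4
        linarith
  · -- the curves cross: the derivative of `(z, z') ↦ d z' - σ d z` is injective
    have hncx : (inner ℝ (c x) (n y) : ℝ) ≠ 0 := by
      intro h
      have hcxd : (inner ℝ (c x) (d y) : ℝ) = 0 := by
        rw [hxy, real_inner_smul_right, F.cd, mul_zero]
      have h1 := F.swap.eq_smul_d hcxd h
      rcases F.swap.inner_d_eq (F.cc x) hcxd h with h2 | h2
      · rw [h2, one_smul] at h1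
        exact hcn (h1 ▸ F.cn x)
      · rw [h2, neg_one_smul] at h1
        refine hcn ?_
        rw [← neg_eq_zero, ← inner_neg_left, ← h1]
        exact F.cn x
    have hτx := right_ne_zero_of_mul hx
    have hτy := right_ne_zero_of_mul hy
    have hd1 : HasFDerivAt (fun p : ℝ × ℝ => d p.2 - σ • d p.1)
        (((ContinuousLinearMap.toSpanSingleton ℝ (-τ y • n y)).comp
          (ContinuousLinearMap.snd ℝ ℝ ℝ)) -
        σ • ((ContinuousLinearMap.toSpanSingleton ℝ (-τ x • n x)).comp
          (ContinuousLinearMap.fst ℝ ℝ ℝ))) (x, y) := by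
      have e2 : HasFDerivAt d (ContinuousLinearMap.toSpanSingleton ℝ (-τ y • n y)) (x, y).2 :=
        (F.hasDerivAt_d y).hasFDerivAt
      have e1 : HasFDerivAt d (ContinuousLinearMap.toSpanSingleton ℝ (-τ x • n x)) (x, y).1 :=
        (F.hasDerivAt_d x).hasFDerivAt
      exact (e2.comp (x, y) hasFDerivAt_snd).sub ((e1.comp (x, y) hasFDerivAt_fst).const_smul σ)
    have hanti : ∃ C, AntilipschitzWith C
        (((ContinuousLinearMap.toSpanSingleton ℝ (-τ y • n y)).comp
          (ContinuousLinearMap.snd ℝ ℝ ℝ)) -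
        σ • ((ContinuousLinearMap.toSpanSingleton ℝ (-τ x • n x)).comp
          (ContinuousLinearMap.fst ℝ ℝ ℝ))) := by
      obtain ⟨C, _, hC⟩ := LinearMap.exists_antilipschitzWith
        (((ContinuousLinearMap.toSpanSingleton ℝ (-τ y • n y)).comp
          (ContinuousLinearMap.snd ℝ ℝ ℝ)) -
        σ • ((ContinuousLinearMap.toSpanSingleton ℝ (-τ x • n x)).comp
          (ContinuousLinearMap.fst ℝ ℝ ℝ)) : ℝ × ℝ →L[ℝ] E3).toLinearMap (by
        rw [LinearMap.ker_eq_bot']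
        rintro ⟨p, q⟩ hpq
        have hpq' : q • (-τ y • n y) - σ • p • (-τ x • n x) = 0 := by simpa using hpq
        have hq : q = 0 := by
          have := congrArg (fun z => (inner ℝ (c x) z : ℝ)) hpq'
          simp only [inner_sub_right, real_inner_smul_right, F.cn, mul_zero, sub_zero,
            inner_zero_right] at this
          simpa [hτy, hncx] using this
        have hp : p = 0 := by
          have := congrArg (fun z => (inner ℝ (n x) z : ℝ)) hpq'
          have hσ0 : σ ≠ 0 := fun h => by simp [h] at hσ2
          simp only [hq, inner_sub_right, real_inner_smul_right, F.nn, zero_mul, zero_sub,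
            inner_zero_right] at this
          simpa [hτx, hσ0] using this
        rw [hp, hq]
        rfl)
      exact ⟨C, hC⟩
    exact (hd1.eventually_ne (c := 0) hanti).mono fun p hp => sub_ne_zero.1 hp

/-- For all but countably many `x`, every zero of `⟨d x, c ·⟩` is simple or is a point where
`± d` touches `d` at `x`, bending to the same side. -/
theorem countable_setOf_exceptional (F : IsGenericFrame L c n d κ τ) :
    {x | ¬ (κ x * τ x ≠ 0 ∧ ∀ y, (inner ℝ (d x) (c y) : ℝ) = 0 →
      ((inner ℝ (d x) (n y) : ℝ) ≠ 0 ∧ κ y ≠ 0) ∨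
      (κ y * τ y ≠ 0 ∧ ∃ σ : ℝ, (σ = 1 ∨ σ = -1) ∧ d y = σ • d x ∧
        SameSide c κ τ σ x y))}.Countable := by
  have hZκ : {y | κ y = 0}.Countable :=
    countable_of_forall_isolated fun y _ => F.isolated_κ y
  have hZτ : {y | τ y = 0}.Countable :=
    countable_of_forall_isolated fun y _ => F.isolated_τ y
  have hd0 : ∀ x, d x ≠ 0 := fun x h => by simpa [h] using F.dd x
  have hc0 : ∀ x, c x ≠ 0 := fun x h => by simpa [h] using F.cc x
  have hB1 : (⋃ y ∈ {y | κ y = 0} ∪ {y | τ y = 0}, ⋃ σ ∈ ({1, -1} : Set ℝ),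
      {x | τ x ≠ 0 ∧ d y = σ • d x}).Countable := by
    refine (hZκ.union hZτ).biUnion fun y _ => (Set.toFinite _).countable.biUnion fun σ hσ => ?_
    have hσ2 : σ * σ = 1 := mul_self_eq_one_iff.2 (by simpa using hσ)
    refine countable_of_forall_isolated fun x hx => ?_
    have hn0 : n x ≠ 0 := fun h => by simpa [h] using F.nn x
    have := (F.hasDerivAt_d x).eventually_ne (c := σ • d y)
      (smul_ne_zero (neg_ne_zero.2 hx.1) hn0)
    exact this.mono fun z hz hz' => hz (by rw [hz'.2, smul_smul, hσ2, one_smul])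
  have hB2 : (⋃ y ∈ {y | κ y = 0}, {x | κ x * τ x ≠ 0 ∧
      (inner ℝ (c y) (d x) : ℝ) = 0}).Countable := by
    refine hZκ.biUnion fun y _ => countable_of_forall_isolated fun x hx => ?_
    have : ∀ᶠ z in 𝓝[≠] x, (inner ℝ (c y) (d z) : ℝ) ≠ 0 := by
      by_cases h : (inner ℝ (c y) (n x) : ℝ) = 0
      · refine F.swap.isolated_of_degenerate (hc0 y) ?_ hx.2 h
        rw [neg_mul_neg, mul_comm]
        exact hx.1
      · exact F.swap.isolated_of_inner_n_ne hx.2 h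
    exact this.mono fun z hz hz' => hz hz'.2
  have hB3 : (⋃ σ ∈ ({1, -1} : Set ℝ), Prod.fst '' {p : ℝ × ℝ | κ p.1 * τ p.1 ≠ 0 ∧
      κ p.2 * τ p.2 ≠ 0 ∧ d p.2 = σ • d p.1 ∧ ¬ SameSide c κ τ σ p.1 p.2}).Countable := by
    refine (Set.toFinite _).countable.biUnion fun σ hσ => Set.Countable.image ?_ _
    refine countable_of_forall_isolated fun p hp => ?_
    exact (F.eventually_ne_of_not_sameSide (by simpa using hσ) hp.1 hp.2.1 hp.2.2.1
      hp.2.2.2).mono fun q hq hq' => hq hq'.2.2.1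
  refine ((((hZκ.union hZτ).union hB1).union hB2).union hB3).mono ?_
  intro x hx
  by_contra hcon
  simp only [mem_union, not_or] at hcon
  obtain ⟨⟨⟨⟨h1, h2⟩, h3⟩, h4⟩, h5⟩ := hcon
  refine hx ⟨mul_ne_zero h1 h2, fun y hy => ?_⟩
  by_cases hn : (inner ℝ (d x) (n y) : ℝ) = 0
  · right
    set σ : ℝ := inner ℝ (d x) (d y) with hσdef
    have hσ : σ = 1 ∨ σ = -1 := F.inner_d_eq (F.dd x) hy hn
    have hσ2 : σ * σ = 1 := mul_self_eq_one_iff.2 hσ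
    have hdx : d x = σ • d y := F.eq_smul_d hy hn
    have hdy : d y = σ • d x := by
      conv_rhs => rw [hdx]
      rw [smul_smul, hσ2, one_smul]
    have hσ' : σ ∈ ({1, -1} : Set ℝ) := by simpa using hσ
    have hy0 : κ y * τ y ≠ 0 := by
      intro h
      exact h3 (mem_biUnion (mul_eq_zero.1 h) (mem_biUnion hσ' ⟨h2, hdy⟩))
    refine ⟨hy0, σ, hσ, hdy, ?_⟩
    by_contra hss
    exact h5 (mem_biUnion hσ' ⟨(x, y), ⟨mul_ne_zero h1 h2, hy0, hdy, hss⟩, rfl⟩)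
  · refine Or.inl ⟨hn, fun hκ => h4 (mem_biUnion hκ ⟨mul_ne_zero h1 h2, ?_⟩)⟩
    rw [real_inner_comm]
    exact hy

/-- The number of zeros is not locally constant along the curve `d`. It suffices to see this at
nearby unexceptional points `d x`. Pushing `d x` to the side to which the curve bends
removes all degenerate zeros of `⟨d x, c ·⟩`, since all branches of `± d` through `± d x` bend to
the same side. -/
theorem not_locallyConstantAt_d (F : IsGenericFrame L c n d κ τ) (s : ℝ) :
    ¬ LocallyConstantAt L c (d s) := by
  intro h
  have hnhds : ∀ᶠ x in 𝓝 s, LocallyConstantAt L c (d x) :=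
    (F.continuous_d.tendsto s).eventually h.eventually
  obtain ⟨x, hx, hxc⟩ := (F.countable_setOf_exceptional.dense_compl ℝ).exists_mem_open
    isOpen_interior ⟨s, mem_interior_iff_mem_nhds.2 hnhds⟩
  have hlc : LocallyConstantAt L c (d x) :=
    interior_subset (s := {x | LocallyConstantAt L c (d x)}) hxc
  obtain ⟨hκτ, hgood⟩ := not_not.1 hx
  have hdx0 : d x ≠ 0 := fun h => by simpa [h] using F.dd x
  have hx0 : (inner ℝ (d x) (c x) : ℝ) = 0 := by
    rw [real_inner_comm]
    exact F.cd x
  -- degenerate zeros disappear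
  have hdeg : ∀ y, (inner ℝ (d x) (c y) : ℝ) = 0 → κ y * τ y ≠ 0 →
      (∃ σ : ℝ, (σ = 1 ∨ σ = -1) ∧ d y = σ • d x ∧ SameSide c κ τ σ x y) →
      LocalCount c (map (fun ε : ℝ => d x + ε • ((κ x * τ x) • c x)) (𝓝[>] 0)) y 0 := by
    rintro y hy hy0 ⟨σ, hσ, hdy, ρ, hcy, hpos⟩
    have hσ2 : σ * σ = 1 := mul_self_eq_one_iff.2 hσ
    have hdx : d x = σ • d y := by rw [hdy, smul_smul, hσ2, one_smul]
    refine localCount_zero (σ := σ * (κ y * τ y)) F.continuous_c ?_ ?_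
    · have := F.eventually_pos_of_degenerate (w := d x) (y := y) (σ := σ * (κ y * τ y)) hy
        (by rw [hdx, real_inner_smul_left, F.dn, mul_zero]) (by
          have e : (inner ℝ (d x) (d y) : ℝ) = σ := by
            rw [hdx, real_inner_smul_left, F.dd, mul_one]
          have e2 : σ * (κ y * τ y) * (κ y * τ y * σ) = (κ y * τ y) * (κ y * τ y) := by
            linear_combination ((κ y * τ y) * (κ y * τ y)) * hσ2
          rw [e, e2]
          exact mul_self_pos.2 hy0)
      rw [eventually_nhdsWithin_iff] at this
      refine this.mono fun z hz => ?_
      by_cases hzy : z = y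
      · rw [hzy, hy, mul_zero]
      · exact (hz hzy).le
    · rw [real_inner_smul_left, hcy, real_inner_smul_right, F.cc]
      nlinarith
  refine F.not_locallyConstantAt_of_drop hx0 ?_ (hdeg x hx0 hκτ ⟨1, Or.inl rfl, by simp, 1,
    by simp, by simpa using mul_self_pos.2 hκτ⟩) ?_ hlc
  · intro y hy
    by_cases hn : (inner ℝ (d x) (n y) : ℝ) = 0
    · rcases hgood y hy with h1 | h1
      · exact absurd hn h1.1
      · exact F.isolated_of_degenerate hdx0 h1.1 hy hn
    · exact F.isolated_of_inner_n_ne hy hn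
  · intro y _ hy
    rcases hgood y hy with h1 | h1
    · exact Or.inr (localCount_one F.hasDerivAt_c F.continuous_n hy
        (eventually_pos_or_neg F.differentiable_κ.continuous (F.isolated_κ y)
          fun hs => h1.2 hs.1) h1.1)
    · exact Or.inl (hdeg y hy h1.1 h1.2)

/-! ### The number of zeros jumps across tangent great circles at sign changes -/

/-- The number of zeros is not locally constant along the great circle orthogonal to `c s₀` where
`κ` changes sign at `s₀`: moving `v` along the great circle to a general position, the zero `s₀`
of `⟨v, c ·⟩` is an extremum, which can be removed, and all other zeros persist. -/
theorem not_locallyConstantAt_of_changesSignAt (F : IsGenericFrame L c n d κ τ) {v : E3}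
    (hv : v ≠ 0) {s₀ : ℝ} (hs₀ : ChangesSignAt κ s₀) (hvc : (inner ℝ v (c s₀) : ℝ) = 0) :
    ¬ LocallyConstantAt L c v := by
  intro hlc
  -- a second vector orthogonal to `c s₀`, orthogonal to `v`
  set m : E3 := (-(inner ℝ v (d s₀) : ℝ)) • n s₀ + (inner ℝ v (n s₀) : ℝ) • d s₀ with hm
  have hmc : (inner ℝ m (c s₀) : ℝ) = 0 := by
    rw [hm, inner_add_left, real_inner_smul_left, real_inner_smul_left,
      real_inner_comm (c s₀) (n s₀), real_inner_comm (c s₀) (d s₀), F.cn, F.cd]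
    ring
  have hv2 : 0 < (inner ℝ v (n s₀) : ℝ) ^ 2 + (inner ℝ v (d s₀) : ℝ) ^ 2 := by
    by_contra! hcon
    apply hv
    rw [F.expand s₀ v, hvc, show (inner ℝ v (n s₀) : ℝ) = 0 by nlinarith,
      show (inner ℝ v (d s₀) : ℝ) = 0 by nlinarith]
    simp
  have hmn : (inner ℝ m (n s₀) : ℝ) = -inner ℝ v (d s₀) := by
    rw [hm, inner_add_left, real_inner_smul_left, real_inner_smul_left, F.nn, F.dn]
    ring
  have hmd : (inner ℝ m (d s₀) : ℝ) = inner ℝ v (n s₀) := by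
    rw [hm, inner_add_left, real_inner_smul_left, real_inner_smul_left, F.dd,
      real_inner_comm (d s₀) (n s₀), F.dn]
    ring
  -- only countably many `v + θ m` are orthogonal to some `c y ≠ ± c s₀` with `κ y = 0`
  have hbad : (⋃ y ∈ {y | κ y = 0}, {θ : ℝ | (inner ℝ (v + θ • m) (c y) : ℝ) = 0 ∧
      ¬ (c y = c s₀ ∨ c y = -c s₀)}).Countable := by
    refine (countable_of_forall_isolated fun y _ => F.isolated_κ y : Set.Countable
      {y | κ y = 0}).biUnion fun y _ => Set.Subsingleton.countable ?_
    rintro θ ⟨h1, hne⟩ θ' ⟨h2, _⟩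
    rw [inner_add_left, real_inner_smul_left] at h1 h2
    by_contra hθ
    have hm0 : (inner ℝ m (c y) : ℝ) = 0 := by
      have : (θ - θ') * (inner ℝ m (c y) : ℝ) = 0 := by linear_combination h1 - h2
      exact (mul_eq_zero.1 this).resolve_left (sub_ne_zero.2 hθ)
    have hv0 : (inner ℝ v (c y) : ℝ) = 0 := by rw [hm0] at h1; linarith
    have ev : v = (inner ℝ v (n s₀) : ℝ) • n s₀ + (inner ℝ v (d s₀) : ℝ) • d s₀ := by
      conv_lhs => rw [F.expand s₀ v, hvc, zero_smul, zero_add]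
    rw [ev, inner_add_left, real_inner_smul_left, real_inner_smul_left] at hv0
    rw [hm, inner_add_left, real_inner_smul_left, real_inner_smul_left] at hm0
    have hyn : (inner ℝ (n s₀) (c y) : ℝ) = 0 := by
      have : ((inner ℝ v (n s₀) : ℝ) ^ 2 + (inner ℝ v (d s₀) : ℝ) ^ 2) *
          (inner ℝ (n s₀) (c y) : ℝ) = 0 := by
        linear_combination (inner ℝ v (n s₀) : ℝ) * hv0 - (inner ℝ v (d s₀) : ℝ) * hm0
      exact (mul_eq_zero.1 this).resolve_left hv2.ne'
    have hyd : (inner ℝ (d s₀) (c y) : ℝ) = 0 := by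
      have : ((inner ℝ v (n s₀) : ℝ) ^ 2 + (inner ℝ v (d s₀) : ℝ) ^ 2) *
          (inner ℝ (d s₀) (c y) : ℝ) = 0 := by
        linear_combination (inner ℝ v (d s₀) : ℝ) * hv0 + (inner ℝ v (n s₀) : ℝ) * hm0
      exact (mul_eq_zero.1 this).resolve_left hv2.ne'
    rw [real_inner_comm] at hyn hyd
    have hcy := F.swap.eq_smul_d hyd hyn
    rcases F.swap.inner_d_eq (F.cc y) hyd hyn with h | h
    · exact hne (Or.inl (by rw [h, one_smul] at hcy; exact hcy))
    · exact hne (Or.inr (by rw [h, neg_one_smul] at hcy; exact hcy))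
  have ht : ∀ᶠ θ in 𝓝 (0 : ℝ), LocallyConstantAt L c (v + θ • m) := by
    have ht : Tendsto (fun θ : ℝ => v + θ • m) (𝓝 0) (𝓝 (v + (0 : ℝ) • m)) :=
      Continuous.tendsto (by fun_prop) 0
    rw [zero_smul, add_zero] at ht
    exact ht.eventually hlc.eventually
  obtain ⟨θ, hθ, hθi⟩ := (hbad.dense_compl ℝ).exists_mem_open isOpen_interior
    ⟨0, mem_interior_iff_mem_nhds.2 ht⟩
  have hlc' : LocallyConstantAt L c (v + θ • m) :=
    interior_subset (s := {θ | LocallyConstantAt L c (v + θ • m)}) hθi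
  set w := v + θ • m with hw
  have hwc : (inner ℝ w (c s₀) : ℝ) = 0 := by
    rw [hw, inner_add_left, real_inner_smul_left, hvc, hmc]
    ring
  have hw0 : w ≠ 0 := by
    intro h
    have h1 : (inner ℝ w (n s₀) : ℝ) = 0 := by simp [h]
    have h2 : (inner ℝ w (d s₀) : ℝ) = 0 := by simp [h]
    rw [hw, inner_add_left, real_inner_smul_left, hmn] at h1
    rw [hw, inner_add_left, real_inner_smul_left, hmd] at h2
    have : (inner ℝ v (n s₀) : ℝ) ^ 2 + (inner ℝ v (d s₀) : ℝ) ^ 2 = 0 := by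
      linear_combination (inner ℝ v (n s₀) : ℝ) * h1 + (inner ℝ v (d s₀) : ℝ) * h2
    exact hv2.ne' this
  have hwn : ∀ y, (inner ℝ w (c y) : ℝ) = 0 → (inner ℝ w (n y) : ℝ) ≠ 0 := by
    intro y hy hn
    have hwd := F.eq_smul_d hy hn
    have hne : (inner ℝ w (d y) : ℝ) ≠ 0 := by
      intro h
      rw [h, zero_smul] at hwd
      exact hw0 hwd
    rw [hwd] at hlc'
    exact F.not_locallyConstantAt_d y (hlc'.of_smul hne)
  have hcn : Continuous fun x => (inner ℝ w (n x) : ℝ) := continuous_const.inner F.continuous_n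
  obtain ⟨σ, hσ0, hσ⟩ := hs₀.exists_extremum (F.hasDerivAt_inner_c w) hcn (hwn s₀ hwc)
  rw [hwc, mul_zero] at hσ
  have h0 : LocalCount c (map (fun ε : ℝ => w + ε • (σ • c s₀)) (𝓝[>] 0)) s₀ 0 := by
    refine localCount_zero F.continuous_c hσ ?_
    rw [real_inner_smul_left, F.cc, mul_one]
    exact mul_self_pos.2 hσ0
  refine F.not_locallyConstantAt_of_drop hwc
    (fun y hy => F.isolated_of_inner_n_ne hy (hwn y hy)) h0 (fun y hyL hy => ?_) hlc'
  by_cases hys : y = s₀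
  · exact Or.inl (hys ▸ h0)
  refine Or.inr (localCount_one F.hasDerivAt_c F.continuous_n hy
    (eventually_pos_or_neg F.differentiable_κ.continuous (F.isolated_κ y) fun hs => ?_) (hwn y hy))
  have hcy : c y = c s₀ ∨ c y = -c s₀ := by
    by_contra hne
    exact hθ (mem_biUnion hs.1 ⟨hy, hne⟩)
  obtain ⟨k, hk⟩ := F.distinct_c s₀ y hs₀.1 hs.1 hcy
  rw [hk, add_sub_cancel_left, zsmul_eq_mul, abs_mul, abs_of_pos F.pos] at hyL
  have hk1 : |(k : ℝ)| < 1 := by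
    by_contra! h
    nlinarith [F.pos]
  have hk0 : k = 0 := Int.abs_lt_one_iff.1 (by exact_mod_cast hk1)
  exact hys (by simpa [hk0] using hk)

/-- The number of zeros of `⟨v, c ·⟩` is locally constant at `v` unless `v` is a multiple of some
`d s` or orthogonal to `c s` for a sign change `s` of `κ`. -/
theorem locallyConstantAt_iff (F : IsGenericFrame L c n d κ τ) {v : E3}
    (hv : inner ℝ v v = (1 : ℝ)) :
    ¬ LocallyConstantAt L c v ↔ (∃ s, v = d s ∨ v = -d s) ∨
      ∃ s, ChangesSignAt κ s ∧ (inner ℝ v (c s) : ℝ) = 0 := by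
  constructor
  · intro h
    by_contra! hcon
    refine h (F.locallyConstantAt (fun s hs hn => ?_) hcon.2)
    have h1 := F.eq_smul_d hs hn
    rcases F.inner_d_eq hv hs hn with h2 | h2
    · rw [h2, one_smul] at h1
      exact (hcon.1 s).1 h1
    · rw [h2, neg_one_smul] at h1
      exact (hcon.1 s).2 h1
  · rintro (⟨s, rfl | rfl⟩ | ⟨s, hs, hs0⟩)
    · exact F.not_locallyConstantAt_d s
    · intro h
      rw [← neg_one_smul ℝ] at h
      exact F.not_locallyConstantAt_d s (h.of_smul (by norm_num))
    · exact F.not_locallyConstantAt_of_changesSignAt (fun h => by simp [h] at hv) hs hs0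

end IsGenericFrame

/-! ### The graph of the counting map -/

/-- Being locally constant on the sphere and in space is the same, as `zeroCount` depends only on
the direction. -/
theorem mem_sphereGraph_iff {L : ℝ} {c : ℝ → E3} {f : S2 → ℕ∞}
    (hf : ∀ v : S2, f v = zeroCount L c v) (v : S2) :
    v ∈ sphereGraph f ↔ ¬ LocallyConstantAt L c v := by
  refine not_congr ⟨?_, fun h => ?_⟩
  · rintro ⟨U, hU, hvU, hconst⟩
    obtain ⟨O, hO, rfl⟩ := isOpen_induced_iff.1 hU
    have hv1 : ‖(v : E3)‖ = 1 := norm_eq_of_mem_sphere v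
    have hcont : ContinuousAt (fun w : E3 => ‖w‖⁻¹ • w) v :=
      (continuous_norm.continuousAt.inv₀ (by rw [hv1]; exact one_ne_zero)).smul continuousAt_id
    have hO' : ∀ᶠ w : E3 in 𝓝 v, ‖w‖⁻¹ • w ∈ O :=
      hcont.eventually_mem (hO.mem_nhds (by simpa [hv1] using hvU))
    have h0 : ∀ᶠ w : E3 in 𝓝 v, w ≠ 0 :=
      continuousAt_id.eventually_ne (by rintro (h : (v : E3) = 0); simp [h] at hv1)
    filter_upwards [hO', h0] with w hw hw0
    have hn : ‖w‖ ≠ 0 := norm_ne_zero_iff.2 hw0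
    have hmem : ‖w‖⁻¹ • w ∈ Metric.sphere (0 : E3) 1 := by
      rw [mem_sphere_zero_iff_norm, norm_smul, norm_inv, norm_norm, inv_mul_cancel₀ hn]
    have := hconst ⟨_, hmem⟩ hw v hvU
    rwa [hf, hf, zeroCount_smul (inv_ne_zero hn)] at this
  · have h' : ∀ᶠ w : S2 in 𝓝 v, zeroCount L c (w : E3) = zeroCount L c v :=
      (continuous_subtype_val.tendsto v).eventually h
    obtain ⟨U, hU, hUo, hvU⟩ := mem_nhds_iff.1 h'
    exact ⟨U, hUo, hvU, fun q hq q' hq' => by rw [hf, hf, hU hq, hU hq']⟩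

theorem tangentGreatCircle_neg (C : ℝ → E3) (s : ℝ) :
    tangentGreatCircle (-C) s = tangentGreatCircle C s := by
  ext v
  rw [tangentGreatCircle, tangentGreatCircle, mem_ofPred_eq, mem_ofPred_eq, deriv.neg,
    Submodule.mem_span_pair, Submodule.mem_span_pair]
  constructor <;>
  · rintro ⟨p, q, h⟩
    exact ⟨-p, -q, by simpa using h⟩

namespace IsGenericFrame

variable {L : ℝ} {c n d : ℝ → E3} {κ τ : ℝ → ℝ}

/-- At a zero of `κ`, the great circle tangent to `d` lies in the plane orthogonal to `c`. -/
theorem mem_tangentGreatCircle_iff (F : IsGenericFrame L c n d κ τ) {s : ℝ} (hs : κ s = 0)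
    (v : S2) : v ∈ tangentGreatCircle d s ↔ (inner ℝ (v : E3) (c s) : ℝ) = 0 := by
  rw [tangentGreatCircle, mem_ofPred_eq, (F.hasDerivAt_d s).deriv, Submodule.mem_span_pair]
  constructor
  · rintro ⟨p, q, h⟩
    rw [← h, inner_add_left, real_inner_smul_left, real_inner_smul_left, real_inner_smul_left,
      real_inner_comm (c s) (d s), real_inner_comm (c s) (n s), F.cd, F.cn]
    ring
  · intro h
    have hτ : τ s ≠ 0 := fun h => F.not_both s ⟨hs, h⟩
    refine ⟨inner ℝ (v : E3) (d s), -(inner ℝ (v : E3) (n s)) / τ s, ?_⟩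
    conv_rhs => rw [F.expand s v, h, zero_smul, zero_add]
    rw [smul_smul, show -(inner ℝ (v : E3) (n s)) / τ s * -τ s = (inner ℝ (v : E3) (n s) : ℝ) by
      field_simp, add_comm]

/-- The graph of the map counting the zeros of `⟨v, c ·⟩` consists of the curves `± d` and the great
circles tangent to them at the sign changes of `κ`. -/
theorem sphereGraph_eq (F : IsGenericFrame L c n d κ τ) {f : S2 → ℕ∞}
    (hf : ∀ v : S2, f v = zeroCount L c v) :
    sphereGraph f = sphereTrace d ∪ sphereTrace (-d) ∪
      ⋃ s ∈ {s : ℝ | ChangesSignAt κ s},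
        (tangentGreatCircle d s ∪ tangentGreatCircle (-d) s) := by
  ext v
  have hv : inner ℝ (v : E3) (v : E3) = (1 : ℝ) := by simp
  rw [mem_sphereGraph_iff hf, F.locallyConstantAt_iff hv]
  simp only [tangentGreatCircle_neg, union_self, mem_union, mem_iUnion, sphereTrace,
    mem_ofPred_eq, exists_prop, Pi.neg_apply, exists_or]
  refine or_congr_right (exists_congr fun s => and_congr_right fun hs => ?_)
  exact (F.mem_tangentGreatCircle_iff hs.1 v).symm

end IsGenericFrame

/-! ### The frame of a knot -/

theorem inner_cross_left (x y : E3) : (inner ℝ x (cross x y) : ℝ) = 0 := by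
  simp [cross, PiLp.inner_apply, Fin.sum_univ_three, cross_apply]
  ring

theorem inner_cross_right (x y : E3) : (inner ℝ y (cross x y) : ℝ) = 0 := by
  simp [cross, PiLp.inner_apply, Fin.sum_univ_three, cross_apply]
  ring

theorem inner_cross_self (x y : E3) : (inner ℝ (cross x y) (cross x y) : ℝ) =
    inner ℝ x x * inner ℝ y y - inner ℝ x y ^ 2 := by
  simp [-inner_self_eq_norm_sq_to_K, cross, PiLp.inner_apply, Fin.sum_univ_three, cross_apply]
  ring

theorem contDiff_cross {f g : ℝ → E3} (hf : ContDiff ℝ ∞ f) (hg : ContDiff ℝ ∞ g) :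
    ContDiff ℝ ∞ fun s => cross (f s) (g s) := by
  have hf' := contDiff_euclidean.1 hf
  have hg' := contDiff_euclidean.1 hg
  rw [contDiff_euclidean]
  intro i
  fin_cases i <;> simp [cross, cross_apply] <;>
    exact ((hf' _).mul (hg' _)).sub ((hf' _).mul (hg' _))

/-- The expansion of a vector in an orthonormal frame of space. -/
theorem eq_sum_of_orthonormal {x y z : E3} (hx : inner ℝ x x = (1 : ℝ))
    (hy : inner ℝ y y = (1 : ℝ)) (hz : inner ℝ z z = (1 : ℝ)) (hxy : inner ℝ x y = (0 : ℝ))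
    (hxz : inner ℝ x z = (0 : ℝ)) (hyz : inner ℝ y z = (0 : ℝ)) (w : E3) :
    w = (inner ℝ w x : ℝ) • x + (inner ℝ w y : ℝ) • y + (inner ℝ w z : ℝ) • z := by
  have ho : Orthonormal ℝ ![x, y, z] := by
    rw [orthonormal_iff_ite]
    intro i j
    fin_cases i <;> fin_cases j <;>
      simp [hxy, hxz, hyz, real_inner_comm x y, real_inner_comm x z, real_inner_comm y z] <;>
      simp_all
  let B : OrthonormalBasis (Fin 3) ℝ E3 := OrthonormalBasis.mk ho (by
    rw [ho.linearIndependent.span_eq_top_of_card_eq_finrank' (by simp)])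
  have := B.sum_repr' w
  simp only [B, OrthonormalBasis.coe_mk, Fin.sum_univ_three] at this
  simpa [real_inner_comm] using this.symm

/-- A periodic set that is finite over a period has only isolated points. -/
theorem eventually_notMem_of_finite_period {L : ℝ} (hL : 0 < L) {Z : Set ℝ}
    (hZ : ∀ s, s + L ∈ Z ↔ s ∈ Z) (hfin : (Ico 0 L ∩ Z).Finite) (s : ℝ) :
    ∀ᶠ x in 𝓝[≠] s, x ∉ Z := by
  have hfin' : (Ico (s - L / 2) (s - L / 2 + L) ∩ Z).Finite := by
    rw [← encard_lt_top_iff, ← encard_inter_Ico_eq hL hZ]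
    exact hfin.encard_lt_top
  have h1 : ∀ᶠ x in 𝓝 s, x ∈ Ioo (s - L / 2) (s - L / 2 + L) :=
    Ioo_mem_nhds (by linarith) (by linarith)
  have h2 : ∀ᶠ x in 𝓝 s, x ∉ (Ico (s - L / 2) (s - L / 2 + L) ∩ Z) \ {s} :=
    (hfin'.subset sdiff_subset).isClosed.isOpen_compl.mem_nhds fun h => h.2 rfl
  rw [eventually_nhdsWithin_iff]
  filter_upwards [h1, h2] with x hx1 hx2 hxs hxZ
  exact hx2 ⟨⟨Ioo_subset_Ico_self hx1, hxZ⟩, hxs⟩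

/-- The distinctness of the lines spanned by `f` at the zeros of `g`, extended from one period to
the line. -/
theorem distinct_of_distinct_period {L : ℝ} (hL : 0 < L) {f g : ℝ → E3}
    (hf : ∀ s, f (s + L) = f s ∨ f (s + L) = -f s) (hg : ∀ s, g (s + L) = 0 ↔ g s = 0)
    (h : ∀ s ∈ Ico 0 L, ∀ s' ∈ Ico 0 L, g s = 0 → g s' = 0 → s ≠ s' →
      f s ≠ f s' ∧ f s ≠ -f s') (s s' : ℝ) (hs : g s = 0) (hs' : g s' = 0)
    (hss : f s' = f s ∨ f s' = -f s) : ∃ k : ℤ, s' = s + k • L := by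
  have hfp : Function.Periodic (fun s => ({f s, -f s} : Set E3)) L := by
    intro s
    rcases hf s with h | h <;> simp [h, pair_comm]
  have hgp : Function.Periodic (fun s => g s = 0) L := fun s => propext (hg s)
  have hfm : ∀ s, ({f (toIcoMod hL 0 s), -f (toIcoMod hL 0 s)} : Set E3) = {f s, -f s} := by
    intro s
    rw [← self_sub_toIcoDiv_zsmul]
    exact hfp.sub_zsmul_eq _
  have hgm : ∀ s, g (toIcoMod hL 0 s) = 0 ↔ g s = 0 := by
    intro s
    rw [← self_sub_toIcoDiv_zsmul]
    exact iff_of_eq (hgp.sub_zsmul_eq _)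
  have heq : ({f s', -f s'} : Set E3) = {f s, -f s} := by
    rcases hss with h | h <;> simp [h, pair_comm]
  rw [← hfm, ← hfm s] at heq
  have hmem : f (toIcoMod hL 0 s') ∈ ({f (toIcoMod hL 0 s), -f (toIcoMod hL 0 s)} : Set E3) := by
    rw [← heq]
    simp
  have hmod : toIcoMod hL 0 s = toIcoMod hL 0 s' := by
    by_contra hne
    have := h _ (toIcoMod_mem_Ico' hL s') _ (toIcoMod_mem_Ico' hL s) ((hgm s').2 hs')
      ((hgm s).2 hs) (Ne.symm hne)
    rcases hmem with h1 | h1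
    · exact this.1 h1
    · exact this.2 h1
  obtain ⟨k, hk⟩ := (toIcoMod_eq_toIcoMod hL).1 hmod
  exact ⟨k, by rw [← hk]; ring⟩

/-- The product rule for two curves with constant inner product. -/
theorem inner_deriv_add_eq_zero {f g : ℝ → E3} {f' g' : E3} {s k : ℝ}
    (hf : HasDerivAt f f' s) (hg : HasDerivAt g g' s) (h : ∀ x, inner ℝ (f x) (g x) = k) :
    inner ℝ (f s) g' + inner ℝ f' (g s) = (0 : ℝ) := by
  have h1 := hf.inner ℝ hg
  rw [show (fun x => (inner ℝ (f x) (g x) : ℝ)) = fun _ => k from funext h] at h1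
  exact h1.unique (hasDerivAt_const s k)

namespace KnotConformation

variable {K : KnotConformation} {b : ℝ → E3}

theorem contDiff_t (K : KnotConformation) : ContDiff ℝ ∞ K.t :=
  ((contDiff_infty_iff_deriv (f := K.r)).1 K.smooth).2

theorem periodic_t (K : KnotConformation) (s : ℝ) : K.t (s + K.length) = K.t s := by
  have : (fun x => K.r (x + K.length)) = K.r := funext K.periodic
  rw [t, ← deriv_comp_add_const, this]

theorem periodic_deriv_t (K : KnotConformation) (s : ℝ) :
    deriv K.t (s + K.length) = deriv K.t s := by
  have : (fun x => K.t (x + K.length)) = K.t := funext K.periodic_t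
  rw [← deriv_comp_add_const, this]

theorem inner_t_t (K : KnotConformation) (s : ℝ) : inner ℝ (K.t s) (K.t s) = (1 : ℝ) := by
  rw [real_inner_self_eq_norm_sq, t, K.unit_speed, one_pow]

namespace IsBinormal

theorem inner_b_b (hb : K.IsBinormal b) (s : ℝ) : inner ℝ (b s) (b s) = (1 : ℝ) := by
  rw [real_inner_self_eq_norm_sq, hb.unit, one_pow]

theorem inner_n_n (hb : K.IsBinormal b) (s : ℝ) :
    inner ℝ (K.n b s) (K.n b s) = (1 : ℝ) := by
  rw [n, inner_cross_self, hb.inner_b_b, K.inner_t_t, hb.orth_t]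
  norm_num

theorem inner_t_n (_ : K.IsBinormal b) (s : ℝ) : inner ℝ (K.t s) (K.n b s) = (0 : ℝ) :=
  inner_cross_right _ _

theorem inner_b_n (_ : K.IsBinormal b) (s : ℝ) : inner ℝ (b s) (K.n b s) = (0 : ℝ) :=
  inner_cross_left _ _

theorem inner_t_b (hb : K.IsBinormal b) (s : ℝ) : inner ℝ (K.t s) (b s) = (0 : ℝ) := by
  rw [real_inner_comm]
  exact hb.orth_t s

theorem expand (hb : K.IsBinormal b) (s : ℝ) (w : E3) :
    w = (inner ℝ w (K.t s) : ℝ) • K.t s + (inner ℝ w (K.n b s) : ℝ) • K.n b s +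
      (inner ℝ w (b s) : ℝ) • b s :=
  eq_sum_of_orthonormal (K.inner_t_t s) (hb.inner_n_n s) (hb.inner_b_b s) (hb.inner_t_n s)
    (hb.inner_t_b s) (by rw [real_inner_comm]; exact hb.inner_b_n s) w

theorem contDiff_n (hb : K.IsBinormal b) : ContDiff ℝ ∞ (K.n b) :=
  contDiff_cross hb.smooth K.contDiff_t

theorem deriv_t_eq (hb : K.IsBinormal b) (s : ℝ) :
    deriv K.t s = K.curvature b s • K.n b s := by
  conv_lhs => rw [hb.expand s (deriv K.t s)]
  rw [real_inner_comm (K.t s), K.inner_t_deriv_t, real_inner_comm (b s), hb.orth_dt, curvature]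
  simp

theorem hasDerivAt_t (hb : K.IsBinormal b) (s : ℝ) :
    HasDerivAt K.t (K.curvature b s • K.n b s) s := by
  rw [← hb.deriv_t_eq]
  exact (K.contDiff_t.differentiable (by simp) s).hasDerivAt

theorem deriv_b_eq (hb : K.IsBinormal b) (s : ℝ) :
    deriv b s = -K.torsion b s • K.n b s := by
  have hd : HasDerivAt b (deriv b s) s := (hb.smooth.differentiable (by simp) s).hasDerivAt
  have h1 := inner_deriv_add_eq_zero hd hd hb.inner_b_b
  rw [real_inner_comm] at h1
  have h2 := inner_deriv_add_eq_zero hd (hb.hasDerivAt_t s) hb.orth_t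
  rw [real_inner_smul_right, hb.inner_b_n, mul_zero, zero_add] at h2
  conv_lhs => rw [hb.expand s (deriv b s)]
  rw [h2, show (inner ℝ (deriv b s) (b s) : ℝ) = 0 by linarith, torsion]
  simp

theorem hasDerivAt_b (hb : K.IsBinormal b) (s : ℝ) :
    HasDerivAt b (-K.torsion b s • K.n b s) s := by
  rw [← hb.deriv_b_eq]
  exact (hb.smooth.differentiable (by simp) s).hasDerivAt

theorem hasDerivAt_n (hb : K.IsBinormal b) (s : ℝ) :
    HasDerivAt (K.n b) (-K.curvature b s • K.t s + K.torsion b s • b s) s := by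
  have hd : HasDerivAt (K.n b) (deriv (K.n b) s) s :=
    (hb.contDiff_n.differentiable (by simp) s).hasDerivAt
  have h1 := inner_deriv_add_eq_zero hd hd hb.inner_n_n
  rw [real_inner_comm] at h1
  have h2 := inner_deriv_add_eq_zero (hb.hasDerivAt_t s) hd hb.inner_t_n
  rw [real_inner_smul_left, hb.inner_n_n, real_inner_comm] at h2
  have h3 := inner_deriv_add_eq_zero (hb.hasDerivAt_b s) hd hb.inner_b_n
  rw [real_inner_smul_left, hb.inner_n_n, real_inner_comm] at h3
  convert hd using 1
  conv_rhs => rw [hb.expand s (deriv (K.n b) s)]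
  rw [show (inner ℝ (deriv (K.n b) s) (K.n b s) : ℝ) = 0 by linarith,
    show (inner ℝ (deriv (K.n b) s) (K.t s) : ℝ) = -K.curvature b s by linarith,
    show (inner ℝ (deriv (K.n b) s) (b s) : ℝ) = K.torsion b s by linarith, zero_smul, add_zero]

theorem n_ne_zero (hb : K.IsBinormal b) (s : ℝ) : K.n b s ≠ 0 :=
  fun h => by simpa [h] using hb.inner_n_n s

theorem curvature_eq_zero_iff (hb : K.IsBinormal b) (s : ℝ) :
    K.curvature b s = 0 ↔ deriv K.t s = 0 := by
  rw [hb.deriv_t_eq, smul_eq_zero, or_iff_left (hb.n_ne_zero s)]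

theorem torsion_eq_zero_iff (hb : K.IsBinormal b) (s : ℝ) :
    K.torsion b s = 0 ↔ deriv b s = 0 := by
  rw [hb.deriv_b_eq, smul_eq_zero, or_iff_left (hb.n_ne_zero s), neg_eq_zero]

theorem isolated_deriv_t (hK : K.IsGeneric b) (s : ℝ) : ∀ᶠ x in 𝓝[≠] s, deriv K.t x ≠ 0 :=
  eventually_notMem_of_finite_period K.length_pos (Z := {s | deriv K.t s = 0})
    (fun s => by simp [K.periodic_deriv_t]) hK.finite_t s

/-- Going once around the knot, the binormal vector returns up to sign: where `t' ≠ 0` it is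
determined up to sign by `t` and `t'`, and such points are dense. -/
theorem periodic_b (hb : K.IsBinormal b) (hK : K.IsGeneric b) (s : ℝ) :
    b (s + K.length) = b s ∨ b (s + K.length) = -b s := by
  have hbc := hb.smooth.continuous
  have hbL : Continuous fun s => b (s + K.length) := hbc.comp (continuous_add_const K.length)
  have hcl : IsClosed {s | b (s + K.length) = b s ∨ b (s + K.length) = -b s} :=
    (isClosed_eq hbL hbc).union (isClosed_eq hbL hbc.neg)
  have hsub : {s | deriv K.t s ≠ 0} ⊆ {s | b (s + K.length) = b s ∨ b (s + K.length) = -b s} := by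
    intro s hs
    have h1 : (inner ℝ (b (s + K.length)) (K.t s) : ℝ) = 0 := by
      rw [← K.periodic_t]
      exact hb.orth_t _
    have h2 : (inner ℝ (b (s + K.length)) (K.n b s) : ℝ) = 0 := by
      have h := hb.orth_dt (s + K.length)
      rw [K.periodic_deriv_t, hb.deriv_t_eq, real_inner_smul_right] at h
      exact (mul_eq_zero.1 h).resolve_left (mt (hb.curvature_eq_zero_iff s).1 hs)
    have h3 := hb.expand s (b (s + K.length))
    rw [h1, h2, zero_smul, zero_smul, zero_add, zero_add] at h3
    have h4 : (inner ℝ (b (s + K.length)) (b s) : ℝ) * inner ℝ (b (s + K.length)) (b s) = 1 := by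
      rw [← hb.inner_b_b (s + K.length)]
      exact ((congrArg (fun x => (inner ℝ (b (s + K.length)) x : ℝ)) h3).trans
        (real_inner_smul_right _ _ _)).symm
    rcases mul_self_eq_one_iff.1 h4 with h | h
    · exact Or.inl (by rw [h, one_smul] at h3; exact h3)
    · exact Or.inr (by rw [h, neg_one_smul] at h3; exact h3)
  have hdense : s ∈ closure {s | deriv K.t s ≠ 0} :=
    mem_closure_of_frequently_of_tendsto (isolated_deriv_t hK s).frequently
      (tendsto_id.mono_left nhdsWithin_le_nhds)
  exact closure_minimal hsub hcl hdense

theorem periodic_deriv_b (hb : K.IsBinormal b) (hK : K.IsGeneric b) (s : ℝ) :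
    deriv b (s + K.length) = 0 ↔ deriv b s = 0 := by
  -- the sign is locally constant, so that it can be differentiated away
  have hbc := hb.smooth.continuous
  have hbL : Continuous fun s => b (s + K.length) := hbc.comp (continuous_add_const K.length)
  have hb0 : ∀ x, b x ≠ -b x := fun x h => by
    have := hb.unit x
    have h0 : b x = 0 := by
      have h2 : (2 : ℝ) • b x = 0 := by rw [two_smul, eq_neg_iff_add_eq_zero.1 h]
      exact (smul_eq_zero.1 h2).resolve_left two_ne_zero
    simp [h0] at this
  rw [← deriv_comp_add_const]
  rcases hb.periodic_b hK s with h | h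
  · have : (fun x => b (x + K.length)) =ᶠ[𝓝 s] b := by
      have hne : ∀ᶠ x in 𝓝 s, b (x + K.length) ≠ -b x :=
        (isOpen_ne_fun hbL hbc.neg).mem_nhds (by rw [mem_ofPred_eq, h]; exact hb0 s)
      filter_upwards [hne] with x hx using (hb.periodic_b hK x).resolve_right hx
    rw [this.deriv_eq]
  · have : (fun x => b (x + K.length)) =ᶠ[𝓝 s] -b := by
      have hne : ∀ᶠ x in 𝓝 s, b (x + K.length) ≠ b x :=
        (isOpen_ne_fun hbL hbc).mem_nhds (by rw [mem_ofPred_eq, h]; exact (hb0 s).symm)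
      filter_upwards [hne] with x hx using (hb.periodic_b hK x).resolve_left hx
    rw [this.deriv_eq, deriv.neg, neg_eq_zero]

/-- The frame `t, n, b` of a generic knot; its reverse `b, n, t` is `IsGenericFrame.swap` of it. -/
theorem isGenericFrame (hb : K.IsBinormal b) (hK : K.IsGeneric b) :
    IsGenericFrame K.length K.t (K.n b) b (K.curvature b) (K.torsion b) where
  pos := K.length_pos
  cc := K.inner_t_t
  nn := hb.inner_n_n
  dd := hb.inner_b_b
  cn := hb.inner_t_n
  cd := hb.inner_t_b
  dn := hb.inner_b_n
  expand := hb.expand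
  hasDerivAt_c := hb.hasDerivAt_t
  hasDerivAt_n := hb.hasDerivAt_n
  hasDerivAt_d := hb.hasDerivAt_b
  differentiable_κ :=
    ((contDiff_infty_iff_deriv.1 K.contDiff_t).2.inner ℝ hb.contDiff_n).differentiable (by simp)
  differentiable_τ :=
    (((contDiff_infty_iff_deriv.1 hb.smooth).2.inner ℝ hb.contDiff_n).neg).differentiable
      (by simp)
  periodic_c s := Or.inl (K.periodic_t s)
  periodic_d := hb.periodic_b hK
  not_both s := by
    rw [hb.curvature_eq_zero_iff, hb.torsion_eq_zero_iff]
    exact hK.not_both s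
  isolated_κ s := by
    simp only [ne_eq, hb.curvature_eq_zero_iff]
    exact isolated_deriv_t hK s
  isolated_τ s := by
    simp only [ne_eq, hb.torsion_eq_zero_iff]
    exact eventually_notMem_of_finite_period K.length_pos (Z := {s | deriv b s = 0})
      (hb.periodic_deriv_b hK) hK.finite_b s
  distinct_c s s' := by
    rw [hb.curvature_eq_zero_iff, hb.curvature_eq_zero_iff]
    exact distinct_of_distinct_period K.length_pos (fun s => Or.inl (K.periodic_t s))
      (fun s => by rw [K.periodic_deriv_t]) hK.distinct_t s s'
  distinct_d s s' := by
    rw [hb.torsion_eq_zero_iff, hb.torsion_eq_zero_iff]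
    exact distinct_of_distinct_period K.length_pos (hb.periodic_b hK)
      (hb.periodic_deriv_b hK) hK.distinct_b s s'

end IsBinormal

/-! ### The bridge map and the inflection map count zeros -/

theorem bridgeMap_eq_zeroCount (K : KnotConformation) (v : S2) :
    K.bridgeMap v = zeroCount K.length K.t v := by
  rw [bridgeMap, zeroCount, params]
  congr 1
  ext s
  have h : HasDerivAt K.r (K.t s) s := (K.smooth.differentiable (by simp) s).hasDerivAt
  have h2 := (hasDerivAt_const s (v : E3)).inner ℝ h
  simp only [inner_zero_left, add_zero] at h2
  rw [mem_ofPred_eq, mem_ofPred_eq, h2.deriv]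

theorem projPlane_eq_zero_iff (v : S2) (x : E3) : projPlane v x = 0 ↔ ∃ a : ℝ, a • (v : E3) = x := by
  rw [projPlane, Submodule.starProjection_apply_eq_zero_iff, Submodule.orthogonal_orthogonal,
    Submodule.mem_span_singleton]

/-- A point projects to a cusp or an inflection point if and only if the direction of projection
lies in the osculating plane. -/
theorem inflection_or_cusp_iff (hb : K.IsBinormal b) (v : S2) (s : ℝ) :
    K.ProjectsToInflection b v s ∨ K.ProjectsToCusp v s ↔ (inner ℝ (v : E3) (b s) : ℝ) = 0 := by
  rw [ProjectsToInflection, ProjectsToCusp, deriv_projCurve]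
  have hmem : ∀ x, x ∈ osculatingPlane b s ↔ (inner ℝ (b s) x : ℝ) = 0 := fun x => by
    rw [osculatingPlane, Submodule.mem_orthogonal_singleton_iff_inner_right]
  have hvb : ∀ (x : E3) (a : ℝ), a • (v : E3) = x → x ≠ 0 → (inner ℝ (b s) x : ℝ) = 0 →
      (inner ℝ (v : E3) (b s) : ℝ) = 0 := by
    rintro x a rfl hx h
    rw [real_inner_smul_right, real_inner_comm] at h
    exact (mul_eq_zero.1 h).resolve_left fun ha => hx (by rw [ha, zero_smul])
  have ht0 : K.t s ≠ 0 := fun h => by simpa [h] using K.inner_t_t s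
  constructor
  · rintro (⟨h0, h⟩ | h)
    · have hn : projPlane v (K.n b s) ∈ Submodule.span ℝ {projPlane v (K.t s)} := by
        rw [← h]
        exact Submodule.mem_map_of_mem ((hmem _).2 (hb.inner_b_n s))
      obtain ⟨k, hk⟩ := Submodule.mem_span_singleton.1 hn
      have hk' : projPlane v (K.n b s - k • K.t s) = 0 := by
        rw [map_sub, map_smul, hk, sub_self]
      obtain ⟨a, ha⟩ := (projPlane_eq_zero_iff v _).1 hk'
      refine hvb _ a ha (fun h => ?_) ?_
      · have := congrArg (fun x => (inner ℝ (K.n b s) x : ℝ)) h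
        rw [inner_sub_right, real_inner_smul_right, hb.inner_n_n, real_inner_comm,
          hb.inner_t_n] at this
        simp at this
      · rw [inner_sub_right, real_inner_smul_right, hb.inner_b_n, hb.orth_t]
        ring
    · obtain ⟨a, ha⟩ := (projPlane_eq_zero_iff v _).1 h
      exact hvb _ a ha ht0 (hb.orth_t s)
  · intro h
    by_cases h0 : projPlane v (K.t s) = 0
    · exact Or.inr h0
    refine Or.inl ⟨h0, le_antisymm ?_ ?_⟩
    · -- a relation between the projections of `t` and `n`, from `v` being in their span
      set p : ℝ := inner ℝ (v : E3) (K.t s)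
      set q : ℝ := inner ℝ (v : E3) (K.n b s)
      have hv : (v : E3) = p • K.t s + q • K.n b s := by
        conv_lhs => rw [hb.expand s v, h, zero_smul, add_zero]
      have hπv : projPlane v (v : E3) = 0 := (projPlane_eq_zero_iff v _).2 ⟨1, one_smul _ _⟩
      have hrel : p • projPlane v (K.t s) + q • projPlane v (K.n b s) = 0 := by
        rw [← map_smul, ← map_smul, ← map_add, ← hv, hπv]
      have hq : q ≠ 0 := by
        intro hq
        rw [hq, zero_smul, add_zero] at hrel hv
        rcases smul_eq_zero.1 hrel with hp | hp
        · rw [hp, zero_smul] at hv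
          have : ‖(v : E3)‖ = 1 := by simp
          rw [hv] at this
          simp at this
        · exact h0 hp
      have hn : projPlane v (K.n b s) = (-(p / q)) • projPlane v (K.t s) := by
        have : projPlane v (K.n b s) = q⁻¹ • (q • projPlane v (K.n b s)) := by
          rw [smul_smul, inv_mul_cancel₀ hq, one_smul]
        rw [this, eq_neg_of_add_eq_zero_right hrel, smul_neg, smul_smul, ← neg_smul]
        congr 1
        ring
      rintro _ ⟨x, hx, rfl⟩
      have hxb : (inner ℝ x (b s) : ℝ) = 0 := by
        rw [real_inner_comm]
        exact (hmem x).1 hx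
      rw [ContinuousLinearMap.coe_coe, hb.expand s x, hxb, zero_smul, add_zero, map_add, map_smul,
        map_smul, hn, smul_smul, ← add_smul]
      exact Submodule.smul_mem _ _ (Submodule.mem_span_singleton_self _)
    · rw [Submodule.span_singleton_le_iff_mem]
      exact Submodule.mem_map_of_mem ((hmem _).2 (hb.orth_t s))

theorem inflectionMap_eq_zeroCount (hb : K.IsBinormal b) (v : S2) :
    K.inflectionMap b v = zeroCount K.length b v := by
  simp only [inflectionMap, zeroCount, params, inflection_or_cusp_iff hb]

end KnotConformation

theorem changesSignAt_neg {f : ℝ → ℝ} {s : ℝ} :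
    ChangesSignAt (fun x => -f x) s ↔ ChangesSignAt f s := by
  simp only [ChangesSignAt, neg_eq_zero, neg_lt_zero, neg_pos]
  rw [or_comm]

end

theorem mainTheorem1 (K : KnotConformation) (b : ℝ → E3) (hb : K.IsBinormal b)
    (hK : K.IsGeneric b) :
    sphereGraph K.bridgeMap =
        sphereTrace b ∪ sphereTrace (-b) ∪
          ⋃ s ∈ {s : ℝ | ChangesSignAt (K.curvature b) s},
            (tangentGreatCircle b s ∪ tangentGreatCircle (-b) s) ∧
      sphereGraph (K.inflectionMap b) =
        sphereTrace K.t ∪ sphereTrace (-K.t) ∪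
          ⋃ s ∈ {s : ℝ | ChangesSignAt (K.torsion b) s},
            (tangentGreatCircle K.t s ∪ tangentGreatCircle (-K.t) s) := by
  have F := hb.isGenericFrame hK
  refine ⟨F.sphereGraph_eq K.bridgeMap_eq_zeroCount, ?_⟩
  rw [F.swap.sphereGraph_eq (KnotConformation.inflectionMap_eq_zeroCount hb)]
  simp only [changesSignAt_neg]
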